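/- Let $n\ge 1$ and let $\mathcal G$ be a compact star graph with central vertex $v$ and edges $e_1,\dots,e_n$, where $e_j$ is identified with $[0,\ell_j]$, $\ell_j>0$, the point $0$ being $v$ and $\ell_j$ the outer vertex. Let $p_j,q_j\in L^1([0,\ell_j],\mathbb R)$, $\alpha_j\in[0,\pi)$, and $$J=\begin{pmatrix}0&-1\\1&0\end{pmatrix},\qquad V_j=\begin{pmatrix}p_j&q_j\\q_j&-p_j\end{pmatrix}.$$ In the Hilbert space $\bigoplus_{j=1}^n\big(L^2(e_j,\mathbb C)\oplus L^2(e_j,\mathbb C)\big)$ of functions $\boldsymbol f=(\boldsymbol f_j)_1^n$, $\boldsymbol f_j=(f_j,\widehat f_j)^{\rm t}$, consider the operators acting as $\boldsymbol f_j\mapsto -J\boldsymbol f_j'+V_j\boldsymbol f_j$ on those $\boldsymbol f$ for which every $\boldsymbol f_j$ is absolutely continuous, $-J\boldsymbol f_j'+V_j\boldsymbol f_j\in L^2$, and $\cos\alpha_j\,f_j(\ell_j)+\sin\alpha_j\,\widehat f_j(\ell_j)=0$, with the following condition at $v$: for $\mathcal T_0$, $f_1(v)=\dots=f_n(v)=0$;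 for $\mathcal T_\tau$, $\tau\in(\mathbb R\cup\{\pm\infty\})\setminus\{0\}$, the Robin matching condition $$f_1(v)=\dots=f_n(v),\qquad f_1(v)=\tau\sum_{j=1}^n\widehat f_j(v),$$ the last equation being read as $\sum_{j=1}^n\widehat f_j(v)=0$ if $\tau=\pm\infty$. For $z\in\mathbb C$ let $Y_j(\cdot,z)=(y_{j,kl}(\cdot,z))_{k,l=1}^2$ be the solution of $-JY_j'+V_jY_j=zY_j$ on $e_j$, $Y_j(0,z)=I_2$, and put $$m_j(z)=\frac{y_{j,11}(\ell_j,z)\cos\alpha_j+y_{j,21}(\ell_j,z)\sin\alpha_j}{y_{j,12}(\ell_j,z)\cos\alpha_j+y_{j,22}(\ell_j,z)\sin\alpha_j},\qquad \boldsymbol m_\tau(z)=\frac1\tau+\sum_{j=1}^n m_j(z),\qquad z\in\mathbb C\setminus\mathbb R,$$ with $1/(\pm\infty)=0$. **Theorem.** Let $z\in\mathbb C\setminus\mathbb R$. Then $z\in\rho(\mathcal T_\tau)\cap\rho(\mathcal T_0)$, the denominators of $m_1(z),\dots,m_n(z)$ do not vanish, $\boldsymbol m_\tau$ is holomorphic at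 $z$ with $\boldsymbol m_\tau(z)\ne0$, the difference $(\mathcal T_\tau-z)^{-1}-(\mathcal T_0-z)^{-1}$ is of trace class, and $$\operatorname{tr}\big((\mathcal T_\tau-z)^{-1}-(\mathcal T_0-z)^{-1}\big)=-\frac{\dot{\boldsymbol m}_\tau(z)}{\boldsymbol m_\tau(z)},$$ where the dot denotes $d/dz$. Moreover $\boldsymbol m_\tau$ is, up to a constant factor, the (generalized) perturbation determinant of $\mathcal T_\tau$ with respect to $\mathcal T_0$: for all $a,z\in\mathbb C\setminus\mathbb R$ the operator $(\mathcal T_\tau-z)(\mathcal T_\tau-a)^{-1}(\mathcal T_0-a)(\mathcal T_0-z)^{-1}$ differs from the identity by a trace class operator, and its Fredholm determinant is $$\det\Big((\mathcal T_\tau-z)(\mathcal T_\tau-a)^{-1}(\mathcal T_0-a)(\mathcal T_0-z)^{-1}\Big)=\frac{\boldsymbol m_\tau(z)}{\boldsymbol m_\tau(a)}.$$ -/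

import Mathlib

open MeasureTheory Filter Topology Set

/-! ## Operators in a Hilbert space: resolvents, trace, determinant -/

namespace OperatorTheory

variable {H : Type*} [NormedAddCommGroup H] [InnerProductSpace ℂ H]

/-- The bounded operator `R` is a two-sided inverse of `T - z`: it maps `H` into the domain of `T`,
`(T - z) R g = g` for all `g`, and `R (T - z) f = f` for all `f` in the domain of `T`. -/
def IsResolventAt (T : H →ₗ.[ℂ] H) (z : ℂ) (R : H →L[ℂ] H) : Prop :=
  (∀ g : H, ∃ h : R g ∈ T.domain, T ⟨R g, h⟩ - z • R g = g) ∧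
    ∀ f : T.domain, R (T f - z • (f : H)) = f

/-- The resolvent set `ρ(T)` of an unbounded operator. -/
def resolventSet (T : H →ₗ.[ℂ] H) : Set ℂ := {z | ∃ R : H →L[ℂ] H, IsResolventAt T z R}

open Classical in
/-- The resolvent `(T - z)⁻¹`, for `z ∈ ρ(T)` (and `0` otherwise). -/
noncomputable def resolvent (T : H →ₗ.[ℂ] H) (z : ℂ) : H →L[ℂ] H :=
  if h : z ∈ resolventSet T then h.choose else 0

/-- Trace class operators, as the operators `f ↦ ∑ₖ ⟪xₖ, f⟫ yₖ` with `∑ₖ ‖xₖ‖ ‖yₖ‖ < ∞`. -/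
def IsTraceClass (A : H →L[ℂ] H) : Prop :=
  ∃ x y : ℕ → H, Summable (fun k => ‖x k‖ * ‖y k‖) ∧
    ∀ f : H, HasSum (fun k => inner ℂ (x k) f • y k) (A f)

/-- `A` is of trace class, and its trace is `t`: `∑ᵢ ⟪bᵢ, A bᵢ⟫ = t` for every orthonormal basis. -/
def HasTrace (A : H →L[ℂ] H) (t : ℂ) : Prop :=
  IsTraceClass A ∧
    ∀ (ι : Type) (b : HilbertBasis ι ℂ H), HasSum (fun i => inner ℂ (b i) (A (b i))) t

/-- `A - 1` is of trace class, and the Fredholm determinant of `A` is `d`: for every orthonormal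
basis, the determinants of the finite sections `(⟪bᵢ, A bⱼ⟫)_{i, j ∈ s}` converge to `d`
along the finite index sets `s`. -/
def HasFredholmDet (A : H →L[ℂ] H) (d : ℂ) : Prop :=
  IsTraceClass (A - 1) ∧
    ∀ (ι : Type) (b : HilbertBasis ι ℂ H),
      Tendsto
        (fun s : Finset ι => by
          classical exact
            (Matrix.of fun i j : s => inner ℂ (b (i : ι)) (A (b (j : ι)))).det)
        atTop (𝓝 d)

/-- `D` is, off the real axis, a (generalized) perturbation determinant of `T` with respect to
`T₀`: it is holomorphic and without zeros, and, with the operators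
`(T - z)(T - a)⁻¹ = 1 + (a - z)(T - a)⁻¹` and `(T₀ - a)(T₀ - z)⁻¹ = 1 + (z - a)(T₀ - z)⁻¹`,
`D z / D a = det ((T - z)(T - a)⁻¹ (T₀ - a)(T₀ - z)⁻¹)` for all nonreal `a`, `z`.
This determines `D` up to a constant factor. -/
def IsPerturbationDeterminant (T T₀ : H →ₗ.[ℂ] H) (D : ℂ → ℂ) : Prop :=
  (∀ z : ℂ, z.im ≠ 0 → z ∈ resolventSet T ∧ z ∈ resolventSet T₀ ∧
    DifferentiableAt ℂ D z ∧ D z ≠ 0) ∧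
  ∀ a z : ℂ, a.im ≠ 0 → z.im ≠ 0 →
    HasFredholmDet
      ((1 + (a - z) • resolvent T a) * (1 + (z - a) • resolvent T₀ z)) (D z / D a)

end OperatorTheory

/-! ## Dirac-Krein operators on a compact star graph -/

/-- A compact star graph with `n` edges, the `j`-th edge being identified with `[0, len j]`, where
`0` is the central vertex and `len j` the outer vertex; real potentials `p j`, `q j` in `L¹`, and
parameters `α j ∈ [0, π)` of the boundary conditions at the outer vertices. -/
structure DiracStarGraph (n : ℕ) where
  len : Fin n → ℝ
  len_pos : ∀ j, 0 < len j
  p : Fin n → ℝ → ℝ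
  q : Fin n → ℝ → ℝ
  p_integrable : ∀ j, IntegrableOn (p j) (Icc 0 (len j))
  q_integrable : ∀ j, IntegrableOn (q j) (Icc 0 (len j))
  α : Fin n → ℝ
  α_mem : ∀ j, α j ∈ Ico 0 Real.pi

namespace DiracStarGraph

variable {n : ℕ}

/-- Lebesgue measure on the `j`-th edge. -/
noncomputable abbrev μ (G : DiracStarGraph n) (j : Fin n) : Measure ℝ :=
  volume.restrict (Icc 0 (G.len j))

/-- The Hilbert space `L²(e_j) = L²(e_j, ℂ) ⊕ L²(e_j, ℂ)`. -/
abbrev EdgeSpace (G : DiracStarGraph n) (j : Fin n) : Type :=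
  WithLp 2 (Lp ℂ 2 (G.μ j) × Lp ℂ 2 (G.μ j))

/-- The Hilbert space `L²(e_1) ⊕ ⋯ ⊕ L²(e_n)`. -/
abbrev Space (G : DiracStarGraph n) : Type :=
  PiLp 2 fun j : Fin n => G.EdgeSpace j

/-- The matrix `J`. -/
def J : Matrix (Fin 2) (Fin 2) ℂ := !![0, -1; 1, 0]

/-- The matrix potential on the `j`-th edge. -/
noncomputable def V (G : DiracStarGraph n) (j : Fin n) (x : ℝ) : Matrix (Fin 2) (Fin 2) ℂ :=
  !![(G.p j x : ℂ), (G.q j x : ℂ); (G.q j x : ℂ), -(G.p j x : ℂ)]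

/-- `F` and `Fh` are absolutely continuous representatives on the `j`-th edge of the components
of `f`, and `-J (F, Fh)' + V (F, Fh) = g` almost everywhere. -/
def IsEdgeRep (G : DiracStarGraph n) (j : Fin n) (f g : G.EdgeSpace j) (F Fh : ℝ → ℂ) : Prop :=
  AbsolutelyContinuousOnInterval F 0 (G.len j) ∧
  AbsolutelyContinuousOnInterval Fh 0 (G.len j) ∧
  f.fst =ᵐ[G.μ j] F ∧ f.snd =ᵐ[G.μ j] Fh ∧
  ∀ᵐ x ∂(G.μ j), ∃ d dh : ℂ, HasDerivAt F d x ∧ HasDerivAt Fh dh x ∧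
    -(J.mulVec ![d, dh]) + (G.V j x).mulVec ![F x, Fh x] = ![g.fst x, g.snd x]

/-- The boundary condition at the outer vertex of the `j`-th edge. -/
def OuterBC (G : DiracStarGraph n) (j : Fin n) (F Fh : ℝ → ℂ) : Prop :=
  (Real.cos (G.α j) : ℂ) * F (G.len j) + (Real.sin (G.α j) : ℂ) * Fh (G.len j) = 0

theorem edge_eq_iff (G : DiracStarGraph n) (j : Fin n) (x : ℝ) (d dh a b u v : ℂ) :
    -(J.mulVec ![d, dh]) + (G.V j x).mulVec ![a, b] = ![u, v] ↔
      dh + ((G.p j x : ℂ) * a + (G.q j x : ℂ) * b) = u ∧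
        -d + ((G.q j x : ℂ) * a - (G.p j x : ℂ) * b) = v := by
  simp only [J, V, Matrix.cons_mulVec, Matrix.cons_dotProduct, Matrix.dotProduct_of_isEmpty,
    Matrix.empty_mulVec, Matrix.vecHead, Matrix.vecTail, funext_iff, Fin.forall_fin_two]
  simp [sub_eq_add_neg, mul_comm]

theorem IsEdgeRep.add {G : DiracStarGraph n} {j : Fin n} {f g f' g' : G.EdgeSpace j}
    {F Fh F' Fh' : ℝ → ℂ} (h : G.IsEdgeRep j f g F Fh) (h' : G.IsEdgeRep j f' g' F' Fh') :
    G.IsEdgeRep j (f + f') (g + g') (F + F') (Fh + Fh') := by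
  obtain ⟨h1, h2, h3, h4, h5⟩ := h
  obtain ⟨h1', h2', h3', h4', h5'⟩ := h'
  refine ⟨h1.add h1', h2.add h2', (Lp.coeFn_add _ _).trans (h3.add h3'),
    (Lp.coeFn_add _ _).trans (h4.add h4'), ?_⟩
  filter_upwards [h5, h5', Lp.coeFn_add g.fst g'.fst, Lp.coeFn_add g.snd g'.snd]
    with x ⟨d, dh, hd, hdh, e⟩ ⟨d', dh', hd', hdh', e'⟩ a1 a2
  refine ⟨d + d', dh + dh', hd.add hd', hdh.add hdh', ?_⟩
  rw [edge_eq_iff] at e e' ⊢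
  refine ⟨Eq.trans ?_ a1.symm, Eq.trans ?_ a2.symm⟩
  · simp only [Pi.add_apply]
    rw [← e.1, ← e'.1]; ring
  · simp only [Pi.add_apply]
    rw [← e.2, ← e'.2]; ring

theorem IsEdgeRep.smul {G : DiracStarGraph n} {j : Fin n} {f g : G.EdgeSpace j}
    {F Fh : ℝ → ℂ} (c : ℂ) (h : G.IsEdgeRep j f g F Fh) :
    G.IsEdgeRep j (c • f) (c • g) (c • F) (c • Fh) := by
  obtain ⟨h1, h2, h3, h4, h5⟩ := h
  refine ⟨h1.const_smul c, h2.const_smul c, (Lp.coeFn_smul _ _).trans (h3.const_smul c),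
    (Lp.coeFn_smul _ _).trans (h4.const_smul c), ?_⟩
  filter_upwards [h5, Lp.coeFn_smul c g.fst, Lp.coeFn_smul c g.snd]
    with x ⟨d, dh, hd, hdh, e⟩ a1 a2
  refine ⟨c • d, c • dh, hd.const_smul c, hdh.const_smul c, ?_⟩
  rw [edge_eq_iff] at e ⊢
  refine ⟨Eq.trans ?_ a1.symm, Eq.trans ?_ a2.symm⟩
  · simp only [Pi.smul_apply, smul_eq_mul]
    rw [← e.1]; ring
  · simp only [Pi.smul_apply, smul_eq_mul]
    rw [← e.2]; ring

theorem IsEdgeRep.zero (G : DiracStarGraph n) (j : Fin n) :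
    G.IsEdgeRep j 0 0 0 0 := by
  have hac : AbsolutelyContinuousOnInterval (0 : ℝ → ℂ) 0 (G.len j) := by
    have : LipschitzOnWith 0 (0 : ℝ → ℂ) (uIcc 0 (G.len j)) := by
      intro x _ y _; simp
    exact this.absolutelyContinuousOnInterval
  refine ⟨hac, hac, Lp.coeFn_zero _ _ _, Lp.coeFn_zero _ _ _, ?_⟩
  filter_upwards [Lp.coeFn_zero ℂ 2 (G.μ j)] with x a1
  refine ⟨0, 0, hasDerivAt_const _ _, hasDerivAt_const _ _, ?_⟩
  rw [edge_eq_iff]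
  exact ⟨Eq.trans (by simp) a1.symm, Eq.trans (by simp) a1.symm⟩

/-- An element of `L²(e_j)` has at most one image under the differential expression. -/
theorem IsEdgeRep.eq_zero {G : DiracStarGraph n} {j : Fin n} {g : G.EdgeSpace j}
    {F Fh : ℝ → ℂ} (h : G.IsEdgeRep j 0 g F Fh) : g = 0 := by
  obtain ⟨h1, h2, h3, h4, h5⟩ := h
  have hL := G.len_pos j
  have key : ∀ K : ℝ → ℂ, AbsolutelyContinuousOnInterval K 0 (G.len j) →
      ((0 : Lp ℂ 2 (G.μ j)) : ℝ → ℂ) =ᵐ[G.μ j] K → EqOn K 0 (Icc 0 (G.len j)) := by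
    intro K hK hK0
    have hc : ContinuousOn K (Icc 0 (G.len j)) := by
      have := hK.continuousOn
      rwa [uIcc_of_le hL.le] at this
    refine Measure.eqOn_Icc_of_ae_eq volume hL.ne ?_ hc continuousOn_const
    exact hK0.symm.trans (Lp.coeFn_zero _ _ _)
  have k1 := key F h1 h3
  have k2 := key Fh h2 h4
  have hIoo : ∀ᵐ x ∂(G.μ j), x ∈ Ioo 0 (G.len j) := by
    have : G.μ j = volume.restrict (Ioo 0 (G.len j)) :=
      (Measure.restrict_congr_set Ioo_ae_eq_Icc).symm
    rw [this]
    exact ae_restrict_mem measurableSet_Ioo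
  have hz : ∀ᵐ x ∂(G.μ j), g.fst x = 0 ∧ g.snd x = 0 := by
    filter_upwards [h5, hIoo] with x ⟨d, dh, hd, hdh, e⟩ hx
    have hnhds : Icc 0 (G.len j) ∈ 𝓝 x := Icc_mem_nhds hx.1 hx.2
    have d0 : d = 0 :=
      hd.unique ((hasDerivAt_const x (0 : ℂ)).congr_of_eventuallyEq
        (eventually_of_mem hnhds k1))
    have dh0 : dh = 0 :=
      hdh.unique ((hasDerivAt_const x (0 : ℂ)).congr_of_eventuallyEq
        (eventually_of_mem hnhds k2))
    have F0 : F x = 0 := k1 (Ioo_subset_Icc_self hx)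
    have Fh0 : Fh x = 0 := k2 (Ioo_subset_Icc_self hx)
    rw [edge_eq_iff, d0, dh0, F0, Fh0] at e
    exact ⟨e.1.symm.trans (by simp), e.2.symm.trans (by simp)⟩
  have g1 : g.fst = 0 := by
    apply Lp.ext
    filter_upwards [hz, Lp.coeFn_zero ℂ 2 (G.μ j)] with x hx h0
    rw [hx.1, h0]; rfl
  have g2 : g.snd = 0 := by
    apply Lp.ext
    filter_upwards [hz, Lp.coeFn_zero ℂ 2 (G.μ j)] with x hx h0
    rw [hx.2, h0]; rfl
  apply (WithLp.equiv 2 _).injective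
  exact Prod.ext g1 g2

/-- The graph of the restriction of `S*` by the vertex condition
`((f_j(0))_j, (fh_j(0))_j) ∈ W` at the central vertex. -/
def opGraph (G : DiracStarGraph n) (W : Submodule ℂ ((Fin n → ℂ) × (Fin n → ℂ))) :
    Submodule ℂ (G.Space × G.Space) where
  carrier := {fg | ∃ F Fh : Fin n → ℝ → ℂ,
    (∀ j, G.IsEdgeRep j (fg.1 j) (fg.2 j) (F j) (Fh j)) ∧
    (∀ j, G.OuterBC j (F j) (Fh j)) ∧
    ((fun j => F j 0, fun j => Fh j 0) : (Fin n → ℂ) × (Fin n → ℂ)) ∈ W}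
  add_mem' := by
    rintro a b ⟨F, Fh, h1, h2, h3⟩ ⟨F', Fh', h1', h2', h3'⟩
    refine ⟨F + F', Fh + Fh', fun j => (h1 j).add (h1' j), fun j => ?_, W.add_mem h3 h3'⟩
    have e := h2 j
    have e' := h2' j
    simp only [OuterBC, Pi.add_apply] at e e' ⊢
    linear_combination e + e'
  zero_mem' := ⟨0, 0, fun j => IsEdgeRep.zero G j, fun j => by simp [OuterBC], W.zero_mem⟩
  smul_mem' := by
    rintro c a ⟨F, Fh, h1, h2, h3⟩
    refine ⟨c • F, c • Fh, fun j => (h1 j).smul c, fun j => ?_, W.smul_mem c h3⟩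
    have e := h2 j
    simp only [OuterBC, Pi.smul_apply, smul_eq_mul] at e ⊢
    linear_combination c * e

/-- The restriction of `S*` by the vertex condition `W`: its domain consists of the functions with
absolutely continuous representatives whose image under the differential expression is in `L²`
and that satisfy the conditions at all the vertices. -/
noncomputable def op (G : DiracStarGraph n) (W : Submodule ℂ ((Fin n → ℂ) × (Fin n → ℂ))) :
    G.Space →ₗ.[ℂ] G.Space :=
  (G.opGraph W).toLinearPMap

/-- The operator `op` does have the graph `opGraph`. -/
theorem op_graph (G : DiracStarGraph n) (W : Submodule ℂ ((Fin n → ℂ) × (Fin n → ℂ))) :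
    (G.op W).graph = G.opGraph W := by
  apply Submodule.toLinearPMap_graph_eq
  rintro ⟨f, g⟩ ⟨F, Fh, h1, -, -⟩ hf
  simp only at hf
  subst hf
  ext1 j
  exact (h1 j).eq_zero

/-- The Dirichlet condition `f_1(v) = ⋯ = f_n(v) = 0` at the central vertex. -/
def dirichlet (n : ℕ) : Submodule ℂ ((Fin n → ℂ) × (Fin n → ℂ)) where
  carrier := {u | ∀ j, u.1 j = 0}
  add_mem' := by intro a b ha hb j; simp [ha j, hb j]
  zero_mem' := by intro j; rfl
  smul_mem' := by intro c a ha j; simp [ha j]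

/-- The Robin matching condition at the central vertex, for `τ ∈ ℝ ∪ {±∞}`:
`f_1(v) = ⋯ = f_n(v)`, and `f_i(v) = τ (fh_1(v) + ⋯ + fh_n(v))` if `τ` is finite,
`fh_1(v) + ⋯ + fh_n(v) = 0` if `τ = ±∞`. -/
def robin (n : ℕ) (τ : EReal) : Submodule ℂ ((Fin n → ℂ) × (Fin n → ℂ)) where
  carrier := {u | (∀ i j, u.1 i = u.1 j) ∧
    (∀ t : ℝ, τ = (t : EReal) → ∀ i, u.1 i = (t : ℂ) * ∑ j, u.2 j) ∧
    (τ = ⊤ ∨ τ = ⊥ → ∑ j, u.2 j = 0)}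
  add_mem' := by
    rintro a b ⟨h1, h2, h3⟩ ⟨h1', h2', h3'⟩
    refine ⟨fun i j => ?_, fun t ht i => ?_, fun hτ => ?_⟩
    · simp [h1 i j, h1' i j]
    · simp only [Prod.fst_add, Prod.snd_add, Pi.add_apply, Finset.sum_add_distrib]
      rw [h2 t ht i, h2' t ht i]; ring
    · simp only [Prod.snd_add, Pi.add_apply, Finset.sum_add_distrib]
      rw [h3 hτ, h3' hτ, add_zero]
  zero_mem' := by simp
  smul_mem' := by
    rintro c a ⟨h1, h2, h3⟩
    refine ⟨fun i j => ?_, fun t ht i => ?_, fun hτ => ?_⟩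
    · simp [h1 i j]
    · simp only [Prod.smul_fst, Prod.smul_snd, Pi.smul_apply, smul_eq_mul, ← Finset.mul_sum]
      rw [h2 t ht i]; ring
    · simp only [Prod.smul_snd, Pi.smul_apply, smul_eq_mul, ← Finset.mul_sum]
      rw [h3 hτ, mul_zero]

/-- The operator `T₀`, with the Dirichlet condition at the central vertex. -/
noncomputable def T₀ (G : DiracStarGraph n) : G.Space →ₗ.[ℂ] G.Space := G.op (dirichlet n)

/-- The operator `T_τ`, with the Robin matching condition at the central vertex. -/
noncomputable def T (G : DiracStarGraph n) (τ : EReal) : G.Space →ₗ.[ℂ] G.Space :=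
  G.op (robin n τ)

/-- `Y` is absolutely continuous on the `j`-th edge, `-J Y' + V Y = z Y` almost everywhere there,
and `Y 0 = 1`. -/
def IsFundamentalMatrix (G : DiracStarGraph n) (j : Fin n) (z : ℂ)
    (Y : ℝ → Matrix (Fin 2) (Fin 2) ℂ) : Prop :=
  (∀ k l, AbsolutelyContinuousOnInterval (fun x => Y x k l) 0 (G.len j)) ∧
  (∀ᵐ x ∂(G.μ j), ∃ D : Matrix (Fin 2) (Fin 2) ℂ,
    (∀ k l, HasDerivAt (fun t => Y t k l) (D k l) x) ∧
    -(J * D) + G.V j x * Y x = z • Y x) ∧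
  Y 0 = 1

open Classical in
/-- The fundamental matrix `Y_j(·, z)`: the solution, unique on the `j`-th edge, of the initial
value problem. -/
noncomputable def Y (G : DiracStarGraph n) (j : Fin n) (z : ℂ) :
    ℝ → Matrix (Fin 2) (Fin 2) ℂ :=
  if h : ∃ Y, G.IsFundamentalMatrix j z Y then h.choose else 0

/-- The numerator of the Weyl-Titchmarsh function of the `j`-th edge. -/
noncomputable def bFun (G : DiracStarGraph n) (j : Fin n) (z : ℂ) : ℂ :=
  G.Y j z (G.len j) 0 0 * (Real.cos (G.α j) : ℂ) + G.Y j z (G.len j) 1 0 * (Real.sin (G.α j) : ℂ)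

/-- The denominator of the Weyl-Titchmarsh function of the `j`-th edge. -/
noncomputable def cFun (G : DiracStarGraph n) (j : Fin n) (z : ℂ) : ℂ :=
  G.Y j z (G.len j) 0 1 * (Real.cos (G.α j) : ℂ) + G.Y j z (G.len j) 1 1 * (Real.sin (G.α j) : ℂ)

/-- The Weyl-Titchmarsh function `m_j` of the `j`-th edge. -/
noncomputable def m (G : DiracStarGraph n) (j : Fin n) (z : ℂ) : ℂ :=
  G.bFun j z / G.cFun j z

/-- The function `m_τ = 1/τ + m_1 + ⋯ + m_n`, with `1/(±∞) = 0`. -/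
noncomputable def mRobin (G : DiracStarGraph n) (τ : EReal) (z : ℂ) : ℂ :=
  ((τ⁻¹).toReal : ℂ) + ∑ j, G.m j z

end DiracStarGraph

/-! ### Resolvents of symmetric operators -/

namespace OperatorTheory

variable {H : Type*} [NormedAddCommGroup H] [InnerProductSpace ℂ H]

/-! The two operators differ only in one matching parameter at `v`, so their resolvents differ by a
rank one operator, and both the trace and the determinant reduce to a single scalar product. Let `ψ
z` be the Weyl solution: on each edge it solves the homogeneous equation at `z`, satisfies the outer
condition, and has values `f_j(v) = 1`, `fh_j(v) = -m_j(z)`. Green's identity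
(`IsRep.inner_sub_inner`) leaves only boundary terms at `v`. It shows that both operators are
symmetric, and that pairing `(T₀ - z) f` with `conj (ψ z)` gives `-∑ fh_j(v)`. Adding to `(T₀ - z)⁻¹
g` the multiple of `ψ z` that restores the Robin condition yields Krein's formula `(T_τ - z)⁻¹ = (T₀
- z)⁻¹ - m_τ(z)⁻¹ ⟪conj (ψ z), ·⟫ ψ z`. A zero of a denominator of `m_j`, or of `m_τ`, would be a
nonreal eigenvalue of a symmetric problem. The same identity gives `(z - a) ⟪conj (ψ a), ψ z⟫ =
m_τ(z) - m_τ(a)`. Letting `z → a` yields `m_τ' = ⟪conj ψ, ψ⟫`, which is the trace up to the factor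
`-1/m_τ`; for fixed `a` and `z` it evaluates the determinant of identity plus rank one. This last
step is the abstract `hasTrace_and_isPerturbationDeterminant_of_krein`. The fundamental matrices,
with merely integrable coefficients, come from a weighted contraction argument. -/

theorem IsResolventAt.resolvent_eq {T : H →ₗ.[ℂ] H} {z : ℂ} {R : H →L[ℂ] H}
    (h : IsResolventAt T z R) : resolvent T z = R := by
  have hz : z ∈ resolventSet T := ⟨R, h⟩
  have h' : IsResolventAt T z (resolvent T z) := by
    rw [resolvent, dif_pos hz]
    exact hz.choose_spec
  ext g
  obtain ⟨hm, e⟩ := h.1 g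
  have := h'.2 ⟨R g, hm⟩
  rwa [e] at this

/-- The factors are `(T - z)(T - a)⁻¹` and `(T - a)(T - z)⁻¹`. -/
theorem IsResolventAt.one_add_mul_one_add {T : H →ₗ.[ℂ] H} {a z : ℂ} {A R : H →L[ℂ] H}
    (hA : IsResolventAt T a A) (hR : IsResolventAt T z R) :
    (1 + (a - z) • A) * (1 + (z - a) • R) = 1 := by
  ext g
  obtain ⟨hm, e⟩ := hR.1 g
  have h2 := hA.2 ⟨R g, hm⟩
  have h3 : T ⟨R g, hm⟩ - a • R g = g + (z - a) • R g := by
    rw [← sub_add_cancel (T ⟨R g, hm⟩) (z • R g), e, sub_smul]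
    abel
  simp only [h3] at h2
  change (g + (z - a) • R g) + (a - z) • A (g + (z - a) • R g) = g
  rw [h2, ← neg_sub z a, neg_smul, add_neg_cancel_right]

/-- Since `⟪f, T f⟫` is real, `Im ⟪f, (T - z) f⟫ = -Im z ‖f‖²`; then Cauchy–Schwarz applies. -/
theorem abs_im_mul_norm_le_of_symmetric {T : H →ₗ.[ℂ] H}
    (hT : ∀ f : T.domain, (inner ℂ (f : H) (T f)).im = 0) (z : ℂ) (f : T.domain) :
    |z.im| * ‖(f : H)‖ ≤ ‖T f - z • (f : H)‖ := by
  have h1 : (inner ℂ (f : H) (T f - z • (f : H))).im = -(z.im * ‖(f : H)‖ ^ 2) := by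
    rw [inner_sub_right, inner_smul_right, inner_self_eq_norm_sq_to_K, Complex.sub_im, hT f,
      Complex.mul_im]
    simp [← Complex.ofReal_pow]
  have h2 := (Complex.abs_im_le_norm _).trans
    (norm_inner_le_norm (𝕜 := ℂ) (f : H) (T f - z • (f : H)))
  rw [h1, abs_neg, abs_mul, abs_of_nonneg (sq_nonneg ‖(f : H)‖)] at h2
  rcases (norm_nonneg (f : H)).eq_or_lt with h | h
  · rw [← h, mul_zero]
    exact norm_nonneg _
  · nlinarith

theorem eq_of_symmetric_of_sub_smul_eq {T : H →ₗ.[ℂ] H}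
    (hT : ∀ f : T.domain, (inner ℂ (f : H) (T f)).im = 0) {z : ℂ} (hz : z.im ≠ 0)
    {f f' : T.domain} (h : T f - z • (f : H) = T f' - z • (f' : H)) : f = f' := by
  have h1 := abs_im_mul_norm_le_of_symmetric hT z (f - f')
  have h2 : T (f - f') - z • ((f - f' : T.domain) : H) = 0 := by
    rw [LinearPMap.map_sub, Submodule.coe_sub, smul_sub, ← sub_eq_zero.2 h]
    abel
  rw [h2, norm_zero] at h1
  have h3 : ‖((f - f' : T.domain) : H)‖ = 0 :=
    le_antisymm (nonpos_of_mul_nonpos_right h1 (abs_pos.2 hz)) (norm_nonneg _)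
  exact sub_eq_zero.1 (Subtype.ext (norm_eq_zero.1 h3))

/-- A right inverse of `T - z` is two-sided, because `T - z` is injective for nonreal `z`. -/
theorem isResolventAt_of_symmetric {T : H →ₗ.[ℂ] H}
    (hT : ∀ f : T.domain, (inner ℂ (f : H) (T f)).im = 0) {z : ℂ} (hz : z.im ≠ 0)
    {R : H →L[ℂ] H} (hR : ∀ g : H, (R g, z • R g + g) ∈ T.graph) : IsResolventAt T z R := by
  have h1 : ∀ g : H, ∃ h : R g ∈ T.domain, T ⟨R g, h⟩ - z • R g = g := by
    intro g
    obtain ⟨u, hu, e⟩ := (LinearPMap.mem_graph_iff _).1 (hR g)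
    simp only at hu e
    have hd : R g ∈ T.domain := hu ▸ u.2
    rw [show u = ⟨R g, hd⟩ from Subtype.ext hu] at e
    exact ⟨hd, by rw [e, add_sub_cancel_left]⟩
  refine ⟨h1, fun f => ?_⟩
  obtain ⟨h, e⟩ := h1 (T f - z • (f : H))
  exact congrArg Subtype.val (eq_of_symmetric_of_sub_smul_eq hT hz e)

/-- The basic criterion: a symmetric operator for which `T - z` is onto has `z` in its resolvent
set. -/
theorem exists_isResolventAt_of_symmetric {T : H →ₗ.[ℂ] H}
    (hT : ∀ f : T.domain, (inner ℂ (f : H) (T f)).im = 0) {z : ℂ} (hz : z.im ≠ 0)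
    (hsurj : ∀ g : H, ∃ f : T.domain, T f - z • (f : H) = g) :
    ∃ R : H →L[ℂ] H, IsResolventAt T z R ∧ ‖R‖ ≤ |z.im|⁻¹ := by
  have hz' : 0 < |z.im| := abs_pos.2 hz
  let S : T.domain →ₗ[ℂ] H := T.toFun - z • T.domain.subtype
  have hS : ∀ f, S f = T f - z • (f : H) := fun _ => rfl
  let e : T.domain ≃ₗ[ℂ] H := LinearEquiv.ofBijective S
    ⟨fun f f' h => eq_of_symmetric_of_sub_smul_eq hT hz h, hsurj⟩
  have he : ∀ g, T (e.symm g) - z • (e.symm g : H) = g := fun g => e.apply_symm_apply g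
  have hb : ∀ g, ‖(T.domain.subtype ∘ₗ e.symm.toLinearMap) g‖ ≤ |z.im|⁻¹ * ‖g‖ := by
    intro g
    have := abs_im_mul_norm_le_of_symmetric hT z (e.symm g)
    rw [he g] at this
    rw [inv_mul_eq_div, le_div_iff₀ hz', mul_comm]
    exact this
  refine ⟨(T.domain.subtype ∘ₗ e.symm.toLinearMap).mkContinuous _ hb, ⟨fun g => ?_, fun f => ?_⟩,
    LinearMap.mkContinuous_norm_le _ (inv_nonneg.2 hz'.le) _⟩
  · exact ⟨(e.symm g).2, he g⟩
  · exact congrArg Subtype.val (e.symm_apply_apply f)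

/-! ### Rank one perturbations and Krein's formula -/

theorem isTraceClass_rankOne (x y : H) : IsTraceClass (InnerProductSpace.rankOne ℂ y x) := by
  refine ⟨Pi.single 0 x, Pi.single 0 y, ?_, fun f => ?_⟩
  · refine summable_of_ne_finset_zero (s := {0}) fun k hk => ?_
    have : k ≠ 0 := by simpa using hk
    simp [this]
  · have := hasSum_single (f := fun k : ℕ => inner ℂ ((Pi.single 0 x : ℕ → H) k) f •
      (Pi.single 0 y : ℕ → H) k) 0 fun k hk => by simp [hk]
    simpa [InnerProductSpace.rankOne_apply] using this

theorem hasTrace_rankOne (x y : H) : HasTrace (InnerProductSpace.rankOne ℂ y x) (inner ℂ x y) := by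
  refine ⟨isTraceClass_rankOne x y, fun ι b => ?_⟩
  simpa [InnerProductSpace.rankOne_apply, inner_smul_right] using b.hasSum_inner_mul_inner x y

/-- By the matrix determinant lemma each finite section has determinant one plus a partial sum of
Parseval's series for `⟪x, y⟫`. -/
theorem hasFredholmDet_one_add_rankOne (x y : H) :
    HasFredholmDet (1 + InnerProductSpace.rankOne ℂ y x) (1 + inner ℂ x y) := by
  classical
  refine ⟨by simpa using isTraceClass_rankOne x y, fun ι b => ?_⟩
  have key := (b.hasSum_inner_mul_inner x y).const_add 1
  refine key.congr fun s => ?_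
  have hM : (Matrix.of fun i j : s => inner ℂ (b (i : ι)) ((1 + InnerProductSpace.rankOne ℂ y x) (b (j : ι)))) =
      1 + Matrix.replicateCol Unit (fun i : s => inner ℂ (b (i : ι)) y) *
        Matrix.replicateRow Unit (fun j : s => inner ℂ x (b (j : ι))) := by
    ext i j
    have hb := (orthonormal_iff_ite.1 b.orthonormal) i j
    simp only [Matrix.of_apply, add_apply, one_apply_eq_self,
      InnerProductSpace.rankOne_apply, inner_add_right, hb, inner_smul_right, Matrix.add_apply, Matrix.one_apply,
      Matrix.mul_apply, Matrix.replicateCol_apply, Matrix.replicateRow_apply,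
      Finset.univ_unique, Finset.sum_singleton, Subtype.ext_iff]
    ring
  rw [hM, Matrix.det_one_add_replicateCol_mul_replicateRow, dotProduct,
    ← Finset.sum_coe_sort s (fun i => inner ℂ x (b i) * inner ℂ (b i) y)]

/-- Krein's resolvent formula with a rank one term, in terms of the deficiency elements `ψ z` and
the conjugates `x z`, gives the trace of the resolvent difference and the perturbation
determinant. -/
theorem hasTrace_and_isPerturbationDeterminant_of_krein [CompleteSpace H]
    {T T₀ : H →ₗ.[ℂ] H} {R : ℂ → H →L[ℂ] H} {x ψ : ℂ → H} {M : ℂ → ℂ}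
    (hR : ∀ z : ℂ, z.im ≠ 0 → IsResolventAt T₀ z (R z))
    (hRn : ∀ z : ℂ, z.im ≠ 0 → ‖R z‖ ≤ |z.im|⁻¹)
    (hT : ∀ z : ℂ, z.im ≠ 0 →
      IsResolventAt T z (R z - (M z)⁻¹ • InnerProductSpace.rankOne ℂ (ψ z) (x z)))
    (hψ : ∀ a z : ℂ, a.im ≠ 0 → z.im ≠ 0 → ψ z = ψ a + (z - a) • R z (ψ a))
    (hM : ∀ a z : ℂ, a.im ≠ 0 → z.im ≠ 0 → (z - a) * inner ℂ (x a) (ψ z) = M z - M a)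
    (hM0 : ∀ z : ℂ, z.im ≠ 0 → M z ≠ 0) :
    (∀ z : ℂ, z.im ≠ 0 → HasTrace (resolvent T z - resolvent T₀ z) (-(deriv M z / M z))) ∧
      IsPerturbationDeterminant T T₀ M := by
  -- The resolvent bound gives `‖ψ z - ψ a‖ ≤ |z - a| |Im z|⁻¹ ‖ψ a‖`.
  have hcont : ∀ a : ℂ, a.im ≠ 0 → ContinuousAt ψ a := by
    intro a ha
    have hev : ∀ᶠ z : ℂ in 𝓝 a, z.im ≠ 0 :=
      Complex.continuous_im.continuousAt.eventually_ne ha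
    have h0 : Tendsto (fun z : ℂ => ‖z - a‖ * (|z.im|⁻¹ * ‖ψ a‖)) (𝓝 a) (𝓝 0) := by
      have hc : ContinuousAt (fun z : ℂ => ‖z - a‖ * (|z.im|⁻¹ * ‖ψ a‖)) a := by
        have : |a.im| ≠ 0 := abs_ne_zero.2 ha
        have h1 : ContinuousAt (fun z : ℂ => |z.im|) a := by fun_prop
        exact (by fun_prop : ContinuousAt (fun z : ℂ => ‖z - a‖) a).mul
          ((h1.inv₀ this).mul continuousAt_const)
      simpa using hc.tendsto
    rw [ContinuousAt, tendsto_iff_norm_sub_tendsto_zero]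
    refine squeeze_zero' (Eventually.of_forall fun _ => norm_nonneg _) ?_ h0
    filter_upwards [hev] with z hz
    rw [hψ a z ha hz, add_sub_cancel_left, norm_smul]
    gcongr
    exact (R z).le_of_opNorm_le (hRn z hz) _
  -- By `hM` the difference quotient of `M` at `a` is exactly `⟪x a, ψ z⟫`, so continuity of `ψ`
  -- suffices.
  have hderiv : ∀ a : ℂ, a.im ≠ 0 → HasDerivAt M (inner ℂ (x a) (ψ a)) a := by
    intro a ha
    have hev : ∀ᶠ z : ℂ in 𝓝 a, z.im ≠ 0 :=
      Complex.continuous_im.continuousAt.eventually_ne ha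
    rw [hasDerivAt_iff_tendsto_slope]
    have ht : Tendsto (fun z => inner ℂ (x a) (ψ z)) (𝓝[≠] a) (𝓝 (inner ℂ (x a) (ψ a))) :=
      (tendsto_const_nhds.inner (hcont a ha).tendsto).mono_left nhdsWithin_le_nhds
    refine ht.congr' ?_
    filter_upwards [nhdsWithin_le_nhds hev, self_mem_nhdsWithin] with z hz hza
    rw [slope_def_field, ← hM a z ha hz, mul_div_cancel_left₀ _ (sub_ne_zero.2 hza)]
  refine ⟨fun z hz => ?_, fun z hz => ⟨⟨_, hT z hz⟩, ⟨_, hR z hz⟩,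
    (hderiv z hz).differentiableAt, hM0 z hz⟩, fun a z ha hz => ?_⟩
  · have h := hasTrace_rankOne (x z) ((-(M z)⁻¹) • ψ z)
    rw [(hT z hz).resolvent_eq, (hR z hz).resolvent_eq, (hderiv z hz).deriv]
    convert h using 1
    · ext g
      simp [smul_smul, mul_comm]
    · rw [inner_smul_right, div_eq_inv_mul, neg_mul]
  -- Replacing `T` by `T₀` the product would be `1`. The correction has range spanned by `ψ a` and
  -- functional `⟪x a, (1 + (z - a) R z) ·⟫`, whence the adjoint; on `ψ a` this functional is `⟪x a,
  -- ψ z⟫`.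
  · have h := hasFredholmDet_one_add_rankOne
      (ContinuousLinearMap.adjoint (1 + (z - a) • R z) (x a)) ((-((a - z) * (M a)⁻¹)) • ψ a)
    rw [(hT a ha).resolvent_eq, (hR z hz).resolvent_eq]
    convert h using 1
    · have h1 := (hR a ha).one_add_mul_one_add (hR z hz)
      rw [smul_sub, ← add_sub_assoc, sub_mul, h1, sub_eq_add_neg]
      congr 1
      ext g
      simp only [InnerProductSpace.rankOne_apply, ContinuousLinearMap.adjoint_inner_left]
      simp [smul_smul, mul_comm]
    · have h2 : (1 + (z - a) • R z) (ψ a) = ψ z := (hψ a z ha hz).symm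
      rw [inner_smul_right, ContinuousLinearMap.adjoint_inner_left, h2]
      have := hM a z ha hz
      have hne := hM0 a ha
      field_simp
      linear_combination -this

end OperatorTheory

/-! ### Absolutely continuous complex-valued functions -/

theorem LipschitzWith.comp_absolutelyContinuousOnInterval {X Y : Type*} [PseudoMetricSpace X]
    [PseudoMetricSpace Y] {K : NNReal} {φ : X → Y} (hφ : LipschitzWith K φ) {f : ℝ → X} {a b : ℝ}
    (hf : AbsolutelyContinuousOnInterval f a b) :
    AbsolutelyContinuousOnInterval (fun x => φ (f x)) a b := by
  have h0 := Tendsto.const_mul (K : ℝ) hf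
  rw [mul_zero] at h0
  refine squeeze_zero (fun t => Finset.sum_nonneg fun i _ => dist_nonneg) (fun t => ?_) h0
  rw [Finset.mul_sum]
  exact Finset.sum_le_sum fun i _ => hφ.dist_le_mul _ _

theorem AbsolutelyContinuousOnInterval.congr {X : Type*} [PseudoMetricSpace X] {f g : ℝ → X}
    {a b : ℝ} (hf : AbsolutelyContinuousOnInterval f a b) (h : EqOn f g (uIcc a b)) :
    AbsolutelyContinuousOnInterval g a b := by
  rw [absolutelyContinuousOnInterval_iff] at hf ⊢
  intro ε hε
  obtain ⟨δ, hδ, H⟩ := hf ε hε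
  refine ⟨δ, hδ, fun E hE hs => lt_of_eq_of_lt (Finset.sum_congr rfl fun i hi => ?_) (H E hE hs)⟩
  rw [h (hE.1 i hi).1, h (hE.1 i hi).2]

theorem IntervalIntegrable.absolutelyContinuousOnInterval_intervalIntegral_complex {f : ℝ → ℂ}
    {a b c : ℝ} (h : IntervalIntegrable f volume a b) (hc : c ∈ uIcc a b) :
    AbsolutelyContinuousOnInterval (fun x => ∫ v in c..x, f v) a b := by
  have hre : IntervalIntegrable (fun x => (f x).re) volume a b :=
    ⟨h.1.re, h.2.re⟩
  have him : IntervalIntegrable (fun x => (f x).im) volume a b :=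
    ⟨h.1.im, h.2.im⟩
  have h1 := hre.absolutelyContinuousOnInterval_intervalIntegral hc
  have h2 := him.absolutelyContinuousOnInterval_intervalIntegral hc
  have h3 := (Complex.isometry_ofReal.lipschitz.comp_absolutelyContinuousOnInterval h1).add
    ((Complex.isometry_ofReal.lipschitz.comp_absolutelyContinuousOnInterval h2).const_smul
      Complex.I)
  have heq : EqOn ((fun x => ((∫ v in c..x, (f v).re : ℝ) : ℂ)) +
      fun x => Complex.I • ((∫ v in c..x, (f v).im : ℝ) : ℂ)) (fun x => ∫ v in c..x, f v)
      (uIcc a b) := by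
    intro x hx
    have hi : IntervalIntegrable f volume c x :=
      h.mono_set (uIcc_subset_uIcc hc hx)
    have e1 := Complex.reCLM.intervalIntegral_comp_comm hi
    have e2 := Complex.imCLM.intervalIntegral_comp_comm hi
    simp only [Complex.reCLM_apply, Complex.imCLM_apply] at e1 e2
    simp only [Pi.add_apply, smul_eq_mul, mul_comm Complex.I, e1, e2, Complex.re_add_im]
  exact h3.congr heq

/-- Subtracting the primitive of `f'` leaves an absolutely continuous function with derivative zero
almost everywhere, hence a constant. -/
theorem AbsolutelyContinuousOnInterval.integral_eq_sub_of_ae_hasDerivAt {f f' : ℝ → ℂ} {a b : ℝ}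
    (hf : AbsolutelyContinuousOnInterval f a b)
    (hd : ∀ᵐ x, x ∈ uIcc a b → HasDerivAt f (f' x) x) (hi : IntervalIntegrable f' volume a b) :
    ∫ x in a..b, f' x = f b - f a := by
  have hac := hf.sub (hi.absolutelyContinuousOnInterval_intervalIntegral_complex
    (left_mem_uIcc (a := a) (b := b)))
  obtain ⟨C, hC⟩ := hac.const_of_ae_hasDerivAt_zero (by
    filter_upwards [hd, hi.ae_hasDerivAt_integral] with x h1 h2 hx
    have := (h1 hx).sub (h2 hx a left_mem_uIcc)
    rwa [sub_self] at this)
  have e := (hC b right_mem_uIcc).trans (hC a left_mem_uIcc).symm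
  simp only [Pi.sub_apply, intervalIntegral.integral_same, sub_zero] at e
  rw [← e]; ring

/-! ### Carathéodory solutions of linear systems -/

/-- Linear differential equations with integrable coefficients have solutions in the sense of
Carathéodory. -/
theorem exists_continuous_eq_add_integral_of_integrable {E : Type*} [NormedAddCommGroup E]
    [NormedSpace ℝ E] [CompleteSpace E] {L : ℝ} (hL : 0 ≤ L) {A : ℝ → E →L[ℝ] E} {h : ℝ → E}
    (hA : Integrable A) (hh : Integrable h) (u₀ : E) :
    ∃ u : ℝ → E, Continuous u ∧
      ∀ x ∈ Icc 0 L, u x = u₀ + ∫ t in (0 : ℝ)..x, (A t (u t) + h t) := by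
  -- The weight `exp (-2Φ)` (Bielecki's norm) makes the Picard map a contraction on the whole
  -- interval, with constant `1/2`.
  set Φ : ℝ → ℝ := fun x => ∫ t in (0 : ℝ)..x, ‖A t‖ with hΦ
  have hΦc : Continuous Φ := intervalIntegral.continuous_primitive
    (fun a b => hA.norm.intervalIntegrable) 0
  have hΦm : Monotone fun x => Real.exp (2 * Φ x) := by
    intro x y hxy
    refine Real.exp_le_exp.2 (mul_le_mul_of_nonneg_left ?_ zero_le_two)
    have := intervalIntegral.integral_interval_sub_left (μ := volume) (f := fun t => ‖A t‖)
      (a := 0) (b := y) (c := x) hA.norm.intervalIntegrable hA.norm.intervalIntegrable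
    have h2 : 0 ≤ ∫ t in x..y, ‖A t‖ :=
      intervalIntegral.integral_nonneg hxy fun _ _ => norm_nonneg _
    simp only [hΦ]
    linarith
  have hAc : ∀ v : ℝ → E, Continuous v → ∀ a b : ℝ,
      IntervalIntegrable (fun t => A t (v t)) volume a b := by
    intro v hv a b
    obtain ⟨C, hC⟩ := isCompact_uIcc.exists_bound_of_continuousOn (hv.continuousOn (s := uIcc a b))
    refine (hA.norm.mul_const C).intervalIntegrable.mono_fun' ?_ ?_
    · exact (ContinuousLinearMap.id ℝ (E →L[ℝ] E)).aestronglyMeasurable_comp₂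
        hA.aestronglyMeasurable.restrict hv.aestronglyMeasurable
    · refine (ae_restrict_iff' measurableSet_uIoc).2 (Eventually.of_forall fun t ht => ?_)
      exact (A t).le_opNorm_of_le (hC t (uIoc_subset_uIcc ht))
  -- For a monotone function the integral of the derivative is at most the increment, so absolute
  -- continuity of `exp (2Φ)` is not needed.
  have hexp : ∀ x, 0 ≤ x → ∫ t in (0 : ℝ)..x, ‖A t‖ * Real.exp (2 * Φ t) ≤
      Real.exp (2 * Φ x) / 2 := by
    intro x hx
    have hm := (hΦm.monotoneOn (uIcc 0 x)).intervalIntegral_deriv_mem_uIcc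
    rw [uIcc_of_le (sub_nonneg.2 (hΦm hx))] at hm
    have he : ∫ t in (0 : ℝ)..x, deriv (fun x => Real.exp (2 * Φ x)) t =
        2 * ∫ t in (0 : ℝ)..x, ‖A t‖ * Real.exp (2 * Φ t) := by
      rw [← intervalIntegral.integral_const_mul]
      refine intervalIntegral.integral_congr_ae ?_
      filter_upwards [LocallyIntegrable.ae_hasDerivAt_integral hA.norm.locallyIntegrable] with t ht _
      rw [((ht 0).const_mul 2).exp.deriv]
      ring
    have := hm.2
    rw [he] at this
    have h1 : 0 < Real.exp (2 * Φ 0) := Real.exp_pos _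
    linarith
  have hint : ∀ v : ℝ → E, Continuous v → ∀ a b : ℝ,
      IntervalIntegrable (fun t => A t (v t) + h t) volume a b := by
    exact fun v hv a b => (hAc v hv a b).add hh.intervalIntegrable
  -- The unknown is `v = exp (-2Φ) u`; `ext` recovers `u`, with `v` extended by its end values.
  let ext : C(Icc (0 : ℝ) L, E) → ℝ → E := fun v t => Real.exp (2 * Φ t) • v (projIcc 0 L hL t)
  have hext : ∀ v, Continuous (ext v) := fun v => by fun_prop
  let K : C(Icc (0 : ℝ) L, E) → C(Icc (0 : ℝ) L, E) := fun v =>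
    ⟨fun x => Real.exp (-(2 * Φ x)) • (u₀ + ∫ t in (0 : ℝ)..x, (A t (ext v t) + h t)), by
      have := intervalIntegral.continuous_primitive (hint _ (hext v)) 0
      fun_prop⟩
  have hK : ContractingWith (1 / 2) K := by
    refine ⟨by norm_num, LipschitzWith.of_dist_le_mul fun v w => ?_⟩
    rw [ContinuousMap.dist_le (by positivity)]
    rintro ⟨x, hx⟩
    have hexpc : Continuous fun t => Real.exp (2 * Φ t) := by fun_prop
    have hbound : ‖∫ t in (0 : ℝ)..x, (A t (ext v t) - A t (ext w t))‖ ≤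
        Real.exp (2 * Φ x) / 2 * dist v w := by
      refine (intervalIntegral.norm_integral_le_of_norm_le hx.1
        (g := fun t => ‖A t‖ * Real.exp (2 * Φ t) * dist v w) ?_ ?_).trans ?_
      · refine Eventually.of_forall fun t _ => ?_
        rw [← map_sub, mul_assoc]
        refine (A t).le_opNorm_of_le ?_
        rw [← smul_sub, norm_smul, Real.norm_of_nonneg (Real.exp_pos _).le, ← dist_eq_norm]
        gcongr
        exact ContinuousMap.dist_apply_le_dist _
      · exact ((hA.norm.intervalIntegrable).mul_continuousOn hexpc.continuousOn).mul_const _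
      · rw [intervalIntegral.integral_mul_const]
        exact mul_le_mul_of_nonneg_right (hexp x hx.1) dist_nonneg
    have hsub : K v ⟨x, hx⟩ - K w ⟨x, hx⟩ =
        Real.exp (-(2 * Φ x)) • ∫ t in (0 : ℝ)..x, (A t (ext v t) - A t (ext w t)) := by
      simp only [K, ContinuousMap.coe_mk]
      rw [← smul_sub, add_sub_add_left_eq_sub,
        ← intervalIntegral.integral_sub (hint _ (hext v) 0 x) (hint _ (hext w) 0 x)]
      simp only [add_sub_add_right_eq_sub]
    rw [dist_eq_norm, hsub, norm_smul, Real.norm_of_nonneg (Real.exp_pos _).le]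
    refine (mul_le_mul_of_nonneg_left hbound (Real.exp_pos _).le).trans_eq ?_
    have h1 : Real.exp (-(2 * Φ x)) * Real.exp (2 * Φ x) = 1 := by
      rw [← Real.exp_add, neg_add_cancel, Real.exp_zero]
    push_cast
    linear_combination (dist v w / 2) * h1
  refine ⟨ext (hK.fixedPoint K), hext _, fun x hx => ?_⟩
  have e := congrArg (fun v : C(Icc (0 : ℝ) L, E) => Real.exp (2 * Φ x) • v ⟨x, hx⟩)
    hK.fixedPoint_isFixedPt.eq
  simp only [K, ContinuousMap.coe_mk, smul_smul, ← Real.exp_add, add_neg_cancel, Real.exp_zero,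
    one_smul] at e
  have e' : ext (hK.fixedPoint K) x = Real.exp (2 * Φ x) • hK.fixedPoint K ⟨x, hx⟩ := by
    simp only [ext, projIcc_of_mem hL hx]
  rw [e']
  exact e.symm

theorem exists_integrable_eqOn {α F : Type*} [MeasurableSpace α] [NormedAddCommGroup F]
    {μ : Measure α} {s : Set α} (hs : MeasurableSet s) {f : α → F} (hf : IntegrableOn f s μ) :
    ∃ f' : α → F, Integrable f' μ ∧ EqOn f' f s :=
  ⟨s.indicator f, hf.integrable_indicator hs, eqOn_indicator⟩

/-- Linear differential equations with coefficients integrable on an interval have solutions in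
the sense of Carathéodory. -/
theorem exists_continuous_eq_add_integral_of_integrableOn {E : Type*} [NormedAddCommGroup E]
    [NormedSpace ℝ E] [CompleteSpace E] {L : ℝ} (hL : 0 ≤ L) {A : ℝ → E →L[ℝ] E} {h : ℝ → E}
    (hA : IntegrableOn A (Icc 0 L)) (hh : IntegrableOn h (Icc 0 L)) (u₀ : E) :
    ∃ u : ℝ → E, Continuous u ∧
      IntervalIntegrable (fun t => A t (u t) + h t) volume 0 L ∧
      ∀ x ∈ uIcc 0 L, u x = u₀ + ∫ t in (0 : ℝ)..x, (A t (u t) + h t) := by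
  obtain ⟨A', hA', hAA⟩ := exists_integrable_eqOn measurableSet_Icc hA
  obtain ⟨h', hh', hhh⟩ := exists_integrable_eqOn measurableSet_Icc hh
  obtain ⟨u, huc, hu⟩ := exists_continuous_eq_add_integral_of_integrable hL hA' hh' u₀
  have hAu : IntegrableOn (fun t => A t (u t) + h t) (Icc 0 L) := by
    refine Integrable.add ?_ hh
    obtain ⟨C, hC⟩ := isCompact_Icc.exists_bound_of_continuousOn
      (huc.continuousOn (s := Icc 0 L))
    refine (hA.norm.mul_const C).mono' ?_ ?_
    · exact (ContinuousLinearMap.id ℝ (E →L[ℝ] E)).aestronglyMeasurable_comp₂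
        hA.aestronglyMeasurable huc.aestronglyMeasurable
    · refine (ae_restrict_iff' measurableSet_Icc).2 (Eventually.of_forall fun t ht => ?_)
      exact (A t).le_opNorm_of_le (hC t ht)
  have hI : IntervalIntegrable (fun t => A t (u t) + h t) volume 0 L :=
    (intervalIntegrable_iff_integrableOn_Icc_of_le hL).2 hAu
  refine ⟨u, huc, hI, ?_⟩
  rw [uIcc_of_le hL]
  intro x hx
  rw [hu x hx]
  congr 1
  refine intervalIntegral.integral_congr fun t ht => ?_
  rw [uIcc_of_le hx.1] at ht
  have : t ∈ Icc 0 L := ⟨ht.1, ht.2.trans hx.2⟩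
  simp only [hAA this, hhh this]

/-- Planar complex linear differential equations with integrable coefficients have absolutely
continuous solutions. -/
theorem exists_absolutelyContinuous_ae_hasDerivAt {L : ℝ} (hL : 0 ≤ L)
    {A : ℝ → ℂ × ℂ →L[ℝ] ℂ × ℂ} {h : ℝ → ℂ × ℂ} (hA : IntegrableOn A (Icc 0 L))
    (hh : IntegrableOn h (Icc 0 L)) (a b : ℂ) :
    ∃ F Fh : ℝ → ℂ, AbsolutelyContinuousOnInterval F 0 L ∧
      AbsolutelyContinuousOnInterval Fh 0 L ∧ F 0 = a ∧ Fh 0 = b ∧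
      ∀ᵐ x, x ∈ uIcc 0 L → HasDerivAt F (A x (F x, Fh x) + h x).1 x ∧
        HasDerivAt Fh (A x (F x, Fh x) + h x).2 x := by
  obtain ⟨u, huc, hI, hu'⟩ := exists_continuous_eq_add_integral_of_integrableOn hL hA hh (a, b)
  have hI1 : IntervalIntegrable (fun t => (A t (u t) + h t).1) volume 0 L :=
    ⟨hI.1.fst, hI.2.fst⟩
  have hI2 : IntervalIntegrable (fun t => (A t (u t) + h t).2) volume 0 L :=
    ⟨hI.1.snd, hI.2.snd⟩
  have h0 : (0 : ℝ) ∈ uIcc 0 L := left_mem_uIcc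
  have hu1 : ∀ x ∈ uIcc 0 L, a + ∫ t in (0 : ℝ)..x, (A t (u t) + h t).1 = (u x).1 := by
    intro x hx
    rw [hu' x hx, Prod.fst_add]
    congr 1
    exact (ContinuousLinearMap.fst ℝ ℂ ℂ).intervalIntegral_comp_comm (hI.mono_set (uIcc_subset_uIcc h0 hx))
  have hu2 : ∀ x ∈ uIcc 0 L, b + ∫ t in (0 : ℝ)..x, (A t (u t) + h t).2 = (u x).2 := by
    intro x hx
    rw [hu' x hx, Prod.snd_add]
    congr 1
    exact (ContinuousLinearMap.snd ℝ ℂ ℂ).intervalIntegral_comp_comm (hI.mono_set (uIcc_subset_uIcc h0 hx))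
  have hac : ∀ c : ℂ, AbsolutelyContinuousOnInterval (fun _ : ℝ => c) 0 L := fun c =>
    (LipschitzWith.const c).lipschitzOnWith.absolutelyContinuousOnInterval
  refine ⟨fun x => a + ∫ t in (0 : ℝ)..x, (A t (u t) + h t).1,
    fun x => b + ∫ t in (0 : ℝ)..x, (A t (u t) + h t).2, (hac a).add
    (hI1.absolutelyContinuousOnInterval_intervalIntegral_complex h0), (hac b).add
    (hI2.absolutelyContinuousOnInterval_intervalIntegral_complex h0), by simp, by simp, ?_⟩
  filter_upwards [hI1.ae_hasDerivAt_integral, hI2.ae_hasDerivAt_integral] with x h1 h2 hx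
  rw [hu1 x hx, hu2 x hx]
  exact ⟨(h1 hx 0 h0).const_add a, (h2 hx 0 h0).const_add b⟩

/-! ### The Dirac system on one edge: existence and Lagrange's identity -/

namespace DiracStarGraph

variable {n : ℕ}

/-- `F` and `Fh` are absolutely continuous, and `-J (F, Fh)' + V (F, Fh) = (g, gh)` almost
everywhere on the `j`-th edge. -/
def EdgeEq (G : DiracStarGraph n) (j : Fin n) (F Fh g gh : ℝ → ℂ) : Prop :=
  AbsolutelyContinuousOnInterval F 0 (G.len j) ∧
  AbsolutelyContinuousOnInterval Fh 0 (G.len j) ∧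
  ∀ᵐ x ∂(G.μ j), ∃ d dh : ℂ, HasDerivAt F d x ∧ HasDerivAt Fh dh x ∧
    dh + ((G.p j x : ℂ) * F x + (G.q j x : ℂ) * Fh x) = g x ∧
    -d + ((G.q j x : ℂ) * F x - (G.p j x : ℂ) * Fh x) = gh x

theorem isEdgeRep_iff (G : DiracStarGraph n) (j : Fin n) (f g : G.EdgeSpace j) (F Fh : ℝ → ℂ) :
    G.IsEdgeRep j f g F Fh ↔
      f.fst =ᵐ[G.μ j] F ∧ f.snd =ᵐ[G.μ j] Fh ∧ G.EdgeEq j F Fh g.fst g.snd := by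
  simp only [IsEdgeRep, EdgeEq, edge_eq_iff]
  tauto

theorem EdgeEq.congr_right {G : DiracStarGraph n} {j : Fin n} {F Fh g gh g' gh' : ℝ → ℂ}
    (h : G.EdgeEq j F Fh g gh) (h1 : g =ᵐ[G.μ j] g') (h2 : gh =ᵐ[G.μ j] gh') :
    G.EdgeEq j F Fh g' gh' := by
  refine ⟨h.1, h.2.1, ?_⟩
  filter_upwards [h.2.2, h1, h2] with x hx e1 e2
  rwa [e1, e2] at hx

/-- The potentials and `J` are real, so conjugation commutes with the differential expression. -/
theorem EdgeEq.star {G : DiracStarGraph n} {j : Fin n} {F Fh g gh : ℝ → ℂ}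
    (h : G.EdgeEq j F Fh g gh) : G.EdgeEq j (star F) (star Fh) (star g) (star gh) := by
  have hl : LipschitzWith 1 (Star.star : ℂ → ℂ) := (starₗᵢ ℂ : ℂ ≃ₗᵢ⋆[ℂ] ℂ).lipschitz
  refine ⟨hl.comp_absolutelyContinuousOnInterval h.1,
    hl.comp_absolutelyContinuousOnInterval h.2.1, ?_⟩
  filter_upwards [h.2.2] with x ⟨d, dh, hd, hdh, e1, e2⟩
  refine ⟨Star.star d, Star.star dh, hd.star, hdh.star, ?_, ?_⟩
  · simpa using congrArg Star.star e1
  · simpa using congrArg Star.star e2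

theorem memLp_of_absolutelyContinuous {G : DiracStarGraph n} {j : Fin n} {F : ℝ → ℂ}
    (h : AbsolutelyContinuousOnInterval F 0 (G.len j)) : MemLp F 2 (G.μ j) := by
  have hc := h.continuousOn
  rw [uIcc_of_le (G.len_pos j).le] at hc
  obtain ⟨C, hC⟩ := isCompact_Icc.exists_bound_of_continuousOn hc
  exact MemLp.of_bound (hc.aestronglyMeasurable measurableSet_Icc) C
    ((ae_restrict_iff' measurableSet_Icc).2 (Eventually.of_forall hC))

theorem ae_mu_iff (G : DiracStarGraph n) (j : Fin n) {P : ℝ → Prop} :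
    (∀ᵐ x ∂(G.μ j), P x) ↔ ∀ᵐ x, x ∈ uIcc 0 (G.len j) → P x := by
  rw [uIcc_of_le (G.len_pos j).le]
  exact ae_restrict_iff' measurableSet_Icc

theorem EdgeEq.exists_of_integrable (G : DiracStarGraph n) (j : Fin n) (z : ℂ) {g gh : ℝ → ℂ}
    (hg : Integrable g (G.μ j)) (hgh : Integrable gh (G.μ j)) (a b : ℂ) :
    ∃ F Fh : ℝ → ℂ, G.EdgeEq j F Fh (z • F + g) (z • Fh + gh) ∧ F 0 = a ∧ Fh 0 = b := by
  have hL := (G.len_pos j).le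
  let fs := ContinuousLinearMap.fst ℝ ℂ ℂ
  let sn := ContinuousLinearMap.snd ℝ ℂ ℂ
  -- The system solved for the derivatives: `F' = q F - p Fh - z Fh - gh` and `Fh' = -p F - q Fh + z
  -- F + g`.
  let A : ℝ → ℂ × ℂ →L[ℝ] ℂ × ℂ := fun t =>
    G.p j t • ((-sn).prod (-fs)) + G.q j t • (fs.prod (-sn)) + ((-(z • sn)).prod (z • fs))
  let h : ℝ → ℂ × ℂ := fun t => (-gh t, g t)
  have hA : IntegrableOn A (Icc 0 (G.len j)) := by
    have h1 := Integrable.smul_const (G.p_integrable j) ((-sn).prod (-fs))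
    have h2 := Integrable.smul_const (G.q_integrable j) (fs.prod (-sn))
    have h3 : Integrable (fun _ : ℝ => (-(z • sn)).prod (z • fs)) (G.μ j) := integrable_const _
    exact (h1.add h2).add h3
  have hh : IntegrableOn h (Icc 0 (G.len j)) := hgh.neg.prodMk hg
  obtain ⟨F, Fh, h1, h2, h3, h4, h5⟩ := exists_absolutelyContinuous_ae_hasDerivAt hL hA hh a b
  refine ⟨F, Fh, ⟨h1, h2, (ae_mu_iff G j).2 ?_⟩, h3, h4⟩
  filter_upwards [h5] with x hx hm
  refine ⟨_, _, (hx hm).1, (hx hm).2, ?_, ?_⟩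
  · simp [A, h, fs, sn]
    ring
  · simp [A, h, fs, sn]
    ring

/-- Lagrange's identity. -/
theorem EdgeEq.integral_sub {G : DiracStarGraph n} {j : Fin n}
    {F Fh g gh F' Fh' g' gh' : ℝ → ℂ} (h : G.EdgeEq j F Fh g gh) (h' : G.EdgeEq j F' Fh' g' gh')
    (hi : Integrable (fun x => F x * g' x + Fh x * gh' x - (g x * F' x + gh x * Fh' x)) (G.μ j)) :
    ∫ x, (F x * g' x + Fh x * gh' x - (g x * F' x + gh x * Fh' x)) ∂(G.μ j) =
      (Fh 0 * F' 0 - F 0 * Fh' 0) -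
        (Fh (G.len j) * F' (G.len j) - F (G.len j) * Fh' (G.len j)) := by
  have hL := (G.len_pos j).le
  -- This is the Wronskian `F Fh' - Fh F'` (primes naming the second solution). Its derivative is
  -- the integrand, the potential terms cancelling because `V` is symmetric.
  have hac := (h.1.smul h'.2.1).sub (h.2.1.smul h'.1)
  have hI : IntervalIntegrable
      (fun x => F x * g' x + Fh x * gh' x - (g x * F' x + gh x * Fh' x)) volume 0 (G.len j) :=
    (intervalIntegrable_iff_integrableOn_Icc_of_le hL).2 hi
  have key := hac.integral_eq_sub_of_ae_hasDerivAt (by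
    filter_upwards [(ae_mu_iff G j).1 h.2.2, (ae_mu_iff G j).1 h'.2.2] with x hx hx' hm
    obtain ⟨d, dh, hd, hdh, e1, e2⟩ := hx hm
    obtain ⟨d', dh', hd', hdh', e1', e2'⟩ := hx' hm
    have := (hd.mul hdh').sub (hdh.mul hd')
    refine this.congr_deriv (f' := _)
      (g' := F x * g' x + Fh x * gh' x - (g x * F' x + gh x * Fh' x)) ?_
    rw [← e1, ← e2, ← e1', ← e2']
    ring) hI
  rw [intervalIntegral.integral_of_le hL, ← integral_Icc_eq_integral_Ioc] at key
  rw [key]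
  simp only [Pi.sub_apply, smul_eq_mul, Pi.mul_apply]
  ring

end DiracStarGraph

/-! ### Green's identity and Weyl solutions on one edge -/

namespace DiracStarGraph

variable {n : ℕ}

/-- Complex conjugation in `L²(e_j)`. -/
noncomputable def conjEdge {G : DiracStarGraph n} {j : Fin n} (f : G.EdgeSpace j) :
    G.EdgeSpace j :=
  WithLp.toLp 2 (star f.fst, star f.snd)

theorem conjEdge_smul {G : DiracStarGraph n} {j : Fin n} (c : ℂ) (f : G.EdgeSpace j) :
    conjEdge (c • f) = star c • conjEdge f := by
  have h : ∀ u : Lp ℂ 2 (G.μ j), star (c • u) = star c • star u := by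
    intro u
    apply Lp.ext
    filter_upwards [Lp.coeFn_star (c • u), Lp.coeFn_star u, Lp.coeFn_smul c u,
      Lp.coeFn_smul (star c) (star u)] with x h1 h2 h3 h4
    rw [h1, h4, Pi.star_apply, h3, Pi.smul_apply, Pi.smul_apply, h2, Pi.star_apply, star_smul]
  apply (WithLp.equiv 2 _).injective
  exact Prod.ext (h f.fst) (h f.snd)

theorem IsEdgeRep.conj {G : DiracStarGraph n} {j : Fin n} {f g : G.EdgeSpace j}
    {F Fh : ℝ → ℂ} (h : G.IsEdgeRep j f g F Fh) :
    G.IsEdgeRep j (conjEdge f) (conjEdge g) (star F) (star Fh) := by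
  rw [isEdgeRep_iff] at h ⊢
  have hs : ∀ {u : Lp ℂ 2 (G.μ j)} {U : ℝ → ℂ}, u =ᵐ[G.μ j] U →
      (star u : Lp ℂ 2 (G.μ j)) =ᵐ[G.μ j] star U := by
    intro u U hu
    filter_upwards [Lp.coeFn_star u, hu] with x h1 h2
    rw [h1, Pi.star_apply, Pi.star_apply, h2]
  exact ⟨hs h.1, hs h.2.1, h.2.2.star.congr_right (Lp.coeFn_star g.fst).symm
    (Lp.coeFn_star g.snd).symm⟩

theorem OuterBC.star {G : DiracStarGraph n} {j : Fin n} {F Fh : ℝ → ℂ}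
    (h : G.OuterBC j F Fh) : G.OuterBC j (star F) (star Fh) := by
  have := congrArg Star.star h
  simpa [OuterBC, -Complex.ofReal_cos, -Complex.ofReal_sin] using this

/-- Both vectors of outer values are annihilated by the nonzero functional `(cos α, sin α)`, so they
are parallel. -/
theorem OuterBC.wronskian_eq_zero {G : DiracStarGraph n} {j : Fin n} {F Fh F' Fh' : ℝ → ℂ}
    (h : G.OuterBC j F Fh) (h' : G.OuterBC j F' Fh') :
    Fh (G.len j) * F' (G.len j) - F (G.len j) * Fh' (G.len j) = 0 := by
  have hcs : (Real.cos (G.α j) : ℂ) ^ 2 + (Real.sin (G.α j) : ℂ) ^ 2 = 1 := by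
    exact_mod_cast Real.cos_sq_add_sin_sq (G.α j)
  simp only [OuterBC] at h h'
  set c := (Real.cos (G.α j) : ℂ)
  set s := (Real.sin (G.α j) : ℂ)
  linear_combination (-(Fh (G.len j) * F' (G.len j) - F (G.len j) * Fh' (G.len j))) * hcs +
    c * (Fh (G.len j) * h' - Fh' (G.len j) * h) + s * (F' (G.len j) * h - F (G.len j) * h')

/-- Lagrange's identity for the conjugate of the first function and the second one; the outer
boundary term is a vanishing Wronskian. -/
theorem IsEdgeRep.inner_sub_inner {G : DiracStarGraph n} {j : Fin n} {f g f' g' : G.EdgeSpace j}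
    {F Fh F' Fh' : ℝ → ℂ} (h : G.IsEdgeRep j f g F Fh) (h' : G.IsEdgeRep j f' g' F' Fh')
    (hb : G.OuterBC j F Fh) (hb' : G.OuterBC j F' Fh') :
    inner ℂ f g' - inner ℂ g f' = star (Fh 0) * F' 0 - star (F 0) * Fh' 0 := by
  have hw := hb.star.wronskian_eq_zero hb'
  obtain ⟨k1, k2, k3⟩ := (isEdgeRep_iff _ _ _ _ _ _).1 h
  obtain ⟨k1', k2', k3'⟩ := (isEdgeRep_iff _ _ _ _ _ _).1 h'
  have i1 := L2.integrable_inner (𝕜 := ℂ) f.fst g'.fst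
  have i2 := L2.integrable_inner (𝕜 := ℂ) f.snd g'.snd
  have i3 := L2.integrable_inner (𝕜 := ℂ) g.fst f'.fst
  have i4 := L2.integrable_inner (𝕜 := ℂ) g.snd f'.snd
  have hae : (fun x => inner ℂ (f.fst x) (g'.fst x) + inner ℂ (f.snd x) (g'.snd x) -
      (inner ℂ (g.fst x) (f'.fst x) + inner ℂ (g.snd x) (f'.snd x))) =ᵐ[G.μ j]
      fun x => (star F) x * g'.fst x + (star Fh) x * g'.snd x -
        ((star (g.fst : ℝ → ℂ)) x * F' x + (star (g.snd : ℝ → ℂ)) x * Fh' x) := by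
    filter_upwards [k1, k2, k1', k2'] with x e1 e2 e3 e4
    rw [e1, e2, e3, e4]
    simp [mul_comm]
  have key := k3.star.integral_sub k3' (((i1.add i2).sub (i3.add i4)).congr hae)
  rw [hw, sub_zero, ← integral_congr_ae hae] at key
  rw [WithLp.prod_inner_apply, WithLp.prod_inner_apply, L2.inner_def, L2.inner_def, L2.inner_def,
    L2.inner_def]
  have hsum := (integral_sub (i1.add i2) (i3.add i4)).trans
    (congrArg₂ (· - ·) (integral_add i1 i2) (integral_add i3 i4))
  exact hsum.symm.trans key

/-- With a Dirichlet value at `0`, Green's identity reads `(z - z̄) ‖f‖² = 0`. -/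
theorem IsEdgeRep.eq_zero_of_eigen {G : DiracStarGraph n} {j : Fin n} {z : ℂ} (hz : z.im ≠ 0)
    {f : G.EdgeSpace j} {F Fh : ℝ → ℂ} (h : G.IsEdgeRep j f (z • f) F Fh)
    (hb : G.OuterBC j F Fh) (h0 : F 0 = 0) : f = 0 := by
  have e := h.inner_sub_inner h hb hb
  rw [h0, star_zero, mul_zero, zero_mul, sub_zero, inner_smul_left, inner_smul_right,
    ← sub_mul] at e
  refine inner_self_eq_zero.1 ((mul_eq_zero.1 e).resolve_left fun h => hz ?_)
  have := congrArg Complex.im h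
  simp only [Complex.sub_im, Complex.conj_im, Complex.zero_im] at this
  linarith

theorem IsEdgeRep.eqOn_zero {G : DiracStarGraph n} {j : Fin n} {g : G.EdgeSpace j}
    {F Fh : ℝ → ℂ} (h : G.IsEdgeRep j 0 g F Fh) : F 0 = 0 ∧ Fh 0 = 0 := by
  obtain ⟨h1, h2, h3, h4, -⟩ := h
  have hL := G.len_pos j
  have key : ∀ K : ℝ → ℂ, AbsolutelyContinuousOnInterval K 0 (G.len j) →
      ((0 : Lp ℂ 2 (G.μ j)) : ℝ → ℂ) =ᵐ[G.μ j] K → K 0 = 0 := by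
    intro K hK hK0
    have hc : ContinuousOn K (Icc 0 (G.len j)) := by
      have := hK.continuousOn
      rwa [uIcc_of_le hL.le] at this
    exact Measure.eqOn_Icc_of_ae_eq volume hL.ne (hK0.symm.trans (Lp.coeFn_zero _ _ _)) hc
      (continuousOn_const (c := (0 : ℂ))) (left_mem_Icc.2 hL.le)
  exact ⟨key F h1 h3, key Fh h2 h4⟩

theorem EdgeEq.exists_isEdgeRep {G : DiracStarGraph n} {j : Fin n} {z : ℂ} {g : G.EdgeSpace j}
    {F Fh : ℝ → ℂ} (h : G.EdgeEq j F Fh (z • F + g.fst) (z • Fh + g.snd)) :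
    ∃ f : G.EdgeSpace j, G.IsEdgeRep j f (z • f + g) F Fh := by
  have m1 := memLp_of_absolutelyContinuous h.1
  have m2 := memLp_of_absolutelyContinuous h.2.1
  have key : ∀ {U : ℝ → ℂ} (m : MemLp U 2 (G.μ j)) (u : Lp ℂ 2 (G.μ j)),
      z • U + (u : ℝ → ℂ) =ᵐ[G.μ j] ((z • m.toLp U + u : Lp ℂ 2 (G.μ j)) : ℝ → ℂ) := by
    intro U m u
    filter_upwards [m.coeFn_toLp, Lp.coeFn_add (z • m.toLp U) u, Lp.coeFn_smul z (m.toLp U)]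
      with x h1 h2 h3
    rw [h2, Pi.add_apply, Pi.add_apply, h3, Pi.smul_apply, Pi.smul_apply, h1]
  refine ⟨WithLp.toLp 2 (m1.toLp F, m2.toLp Fh), (isEdgeRep_iff _ _ _ _ _ _).2
    ⟨m1.coeFn_toLp, m2.coeFn_toLp, h.congr_right ?_ ?_⟩⟩
  · exact key m1 g.fst
  · exact key m2 g.snd

theorem exists_isEdgeRep (G : DiracStarGraph n) (j : Fin n) (z : ℂ) (g : G.EdgeSpace j)
    (a b : ℂ) : ∃ (f : G.EdgeSpace j) (F Fh : ℝ → ℂ),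
      G.IsEdgeRep j f (z • f + g) F Fh ∧ F 0 = a ∧ Fh 0 = b := by
  have i1 : Integrable g.fst (G.μ j) := (Lp.memLp g.fst).integrable one_le_two
  have i2 : Integrable g.snd (G.μ j) := (Lp.memLp g.snd).integrable one_le_two
  obtain ⟨F, Fh, h, ha, hb⟩ := EdgeEq.exists_of_integrable G j z i1 i2 a b
  obtain ⟨f, hf⟩ := h.exists_isEdgeRep
  exact ⟨f, F, Fh, hf, ha, hb⟩

theorem isFundamentalMatrix_iff (G : DiracStarGraph n) (j : Fin n) (z : ℂ)
    (Y : ℝ → Matrix (Fin 2) (Fin 2) ℂ) :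
    G.IsFundamentalMatrix j z Y ↔ (∀ l, G.EdgeEq j (fun x => Y x 0 l) (fun x => Y x 1 l)
      (z • fun x => Y x 0 l) (z • fun x => Y x 1 l)) ∧ Y 0 = 1 := by
  have hmat : ∀ (x : ℝ) (D : Matrix (Fin 2) (Fin 2) ℂ),
      -(J * D) + G.V j x * Y x = z • Y x ↔ ∀ l,
        D 1 l + ((G.p j x : ℂ) * Y x 0 l + (G.q j x : ℂ) * Y x 1 l) = z * Y x 0 l ∧
        -D 0 l + ((G.q j x : ℂ) * Y x 0 l - (G.p j x : ℂ) * Y x 1 l) = z * Y x 1 l := by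
    intro x D
    simp only [← Matrix.ext_iff, Fin.forall_fin_two, Matrix.add_apply, Matrix.neg_apply,
      Matrix.mul_apply, Fin.sum_univ_two, Matrix.smul_apply, smul_eq_mul, J, V, Matrix.of_apply,
      Matrix.cons_val_zero, Matrix.cons_val_one, zero_mul, zero_add, add_zero, one_mul, neg_mul,
      neg_neg, sub_eq_add_neg]
    tauto
  constructor
  · rintro ⟨h1, h2, h3⟩
    refine ⟨fun l => ⟨h1 0 l, h1 1 l, ?_⟩, h3⟩
    filter_upwards [h2] with x ⟨D, hD, e⟩
    exact ⟨D 0 l, D 1 l, hD 0 l, hD 1 l, (hmat x D).1 e l⟩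
  · rintro ⟨h1, h3⟩
    refine ⟨fun k l => ?_, ?_, h3⟩
    · fin_cases k
      · exact (h1 l).1
      · exact (h1 l).2.1
    · filter_upwards [ae_all_iff.2 fun l => (h1 l).2.2] with x hx
      choose d dh hd hdh e using hx
      refine ⟨Matrix.of ![d, dh], fun k l => ?_, (hmat x _).2 e⟩
      fin_cases k
      · exact hd l
      · exact hdh l

theorem isFundamentalMatrix_Y (G : DiracStarGraph n) (j : Fin n) (z : ℂ) :
    G.IsFundamentalMatrix j z (G.Y j z) := by
  have h : ∃ Y, G.IsFundamentalMatrix j z Y := by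
    have hc := fun a b : ℂ => EdgeEq.exists_of_integrable G j z (integrable_zero ℝ ℂ (G.μ j))
      (integrable_zero ℝ ℂ (G.μ j)) a b
    choose F Fh h ha hb using hc
    refine ⟨fun x => !![F 1 0 x, F 0 1 x; Fh 1 0 x, Fh 0 1 x],
      (isFundamentalMatrix_iff _ _ _ _).2 ⟨fun l => ?_, ?_⟩⟩
    · fin_cases l
      · exact (h 1 0).congr_right (by simp) (by simp)
      · exact (h 0 1).congr_right (by simp) (by simp)
    · ext k l
      fin_cases k <;> fin_cases l <;> simp [ha, hb]
  rw [Y, dif_pos h]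
  exact h.choose_spec

theorem exists_isEdgeRep_Y (G : DiracStarGraph n) (j : Fin n) (z : ℂ) (l : Fin 2) :
    ∃ f : G.EdgeSpace j,
      G.IsEdgeRep j f (z • f) (fun x => G.Y j z x 0 l) (fun x => G.Y j z x 1 l) := by
  have h := ((isFundamentalMatrix_iff _ _ _ _).1 (isFundamentalMatrix_Y G j z)).1 l
  obtain ⟨f, hf⟩ := EdgeEq.exists_isEdgeRep (g := 0) (h.congr_right (g' := _ + _) (gh' := _ + _)
    (by
      filter_upwards [Lp.coeFn_zero ℂ 2 (G.μ j)] with x hx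
      exact (add_eq_left.2 hx).symm)
    (by
      filter_upwards [Lp.coeFn_zero ℂ 2 (G.μ j)] with x hx
      exact (add_eq_left.2 hx).symm))
  exact ⟨f, by rwa [add_zero] at hf⟩

theorem Y_zero (G : DiracStarGraph n) (j : Fin n) (z : ℂ) : G.Y j z 0 = 1 :=
  (isFundamentalMatrix_Y G j z).2.2

/-- Otherwise the second column of `Y` would be an eigenfunction of the Dirichlet problem on the
edge at a nonreal point, hence zero, against `Y 0 = 1`. -/
theorem cFun_ne_zero (G : DiracStarGraph n) (j : Fin n) {z : ℂ} (hz : z.im ≠ 0) :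
    G.cFun j z ≠ 0 := by
  intro h
  obtain ⟨f, hf⟩ := exists_isEdgeRep_Y G j z 1
  have hf0 := hf.eq_zero_of_eigen hz (by rw [OuterBC, ← h, cFun]; ring) (by simp [Y_zero])
  subst hf0
  simpa [Y_zero] using hf.eqOn_zero.2

/-- The Weyl solution of the `j`-th edge. -/
theorem exists_weyl_edge (G : DiracStarGraph n) (j : Fin n) {z : ℂ} (hz : z.im ≠ 0) :
    ∃ (f : G.EdgeSpace j) (F Fh : ℝ → ℂ), G.IsEdgeRep j f (z • f) F Fh ∧ G.OuterBC j F Fh ∧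
      F 0 = 1 ∧ Fh 0 = -G.m j z := by
  obtain ⟨f, hf⟩ := exists_isEdgeRep_Y G j z 0
  obtain ⟨f', hf'⟩ := exists_isEdgeRep_Y G j z 1
  -- First column minus `m` times the second: `m` is the ratio for which the outer condition holds.
  have hr := hf.add (hf'.smul (-G.m j z))
  rw [smul_comm, ← smul_add] at hr
  refine ⟨_, _, _, hr, ?_, by simp [Y_zero], by simp [Y_zero]⟩
  have hm : G.m j z * G.cFun j z = G.bFun j z := div_mul_cancel₀ _ (cFun_ne_zero G j hz)
  simp only [cFun, bFun] at hm
  simp only [OuterBC, Pi.add_apply, Pi.smul_apply, smul_eq_mul]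
  linear_combination -hm

/-- The inhomogeneous Dirichlet problem on the `j`-th edge. -/
theorem exists_dirichlet_edge (G : DiracStarGraph n) (j : Fin n) {z : ℂ} (hz : z.im ≠ 0)
    (g : G.EdgeSpace j) :
    ∃ (f : G.EdgeSpace j) (F Fh : ℝ → ℂ), G.IsEdgeRep j f (z • f + g) F Fh ∧
      G.OuterBC j F Fh ∧ F 0 = 0 := by
  obtain ⟨f, F, Fh, hf, h0, -⟩ := exists_isEdgeRep G j z g 0 0
  obtain ⟨f', hf'⟩ := exists_isEdgeRep_Y G j z 1
  have hc := cFun_ne_zero G j hz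
  -- The second column vanishes at `0` in its first component, so adding `κ` times it repairs the
  -- outer condition and keeps the Dirichlet value.
  set κ : ℂ := -(((Real.cos (G.α j) : ℂ) * F (G.len j) +
    (Real.sin (G.α j) : ℂ) * Fh (G.len j)) / G.cFun j z) with hκ
  have hκc : κ * G.cFun j z = -((Real.cos (G.α j) : ℂ) * F (G.len j) +
      (Real.sin (G.α j) : ℂ) * Fh (G.len j)) := by
    rw [hκ, neg_mul, div_mul_cancel₀ _ hc]
  have hr := hf.add (hf'.smul κ)
  rw [smul_comm, add_right_comm, ← smul_add] at hr
  refine ⟨_, _, _, hr, ?_, by simp [Y_zero, h0]⟩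
  simp only [cFun] at hκc
  simp only [OuterBC, Pi.add_apply, Pi.smul_apply, smul_eq_mul]
  linear_combination hκc

end DiracStarGraph

/-! ### The star graph: symmetric vertex conditions and the Weyl vector -/

namespace DiracStarGraph

variable {n : ℕ}

/-- Complex conjugation in `L²(e_1) ⊕ ⋯ ⊕ L²(e_n)`. -/
noncomputable def conj {G : DiracStarGraph n} (f : G.Space) : G.Space :=
  WithLp.toLp 2 fun j => conjEdge (f j)

/-- `F` and `Fh` are representatives of `f`, their image under the differential expression is `g`,
and they satisfy the conditions at the outer vertices. -/
def IsRep (G : DiracStarGraph n) (f g : G.Space) (F Fh : Fin n → ℝ → ℂ) : Prop :=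
  (∀ j, G.IsEdgeRep j (f j) (g j) (F j) (Fh j)) ∧ ∀ j, G.OuterBC j (F j) (Fh j)

theorem IsRep.add {G : DiracStarGraph n} {f g f' g' : G.Space} {F Fh F' Fh' : Fin n → ℝ → ℂ}
    (h : G.IsRep f g F Fh) (h' : G.IsRep f' g' F' Fh') :
    G.IsRep (f + f') (g + g') (F + F') (Fh + Fh') := by
  refine ⟨fun j => (h.1 j).add (h'.1 j), fun j => ?_⟩
  have e := h.2 j
  have e' := h'.2 j
  simp only [OuterBC, Pi.add_apply] at e e' ⊢
  linear_combination e + e'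

theorem IsRep.smul {G : DiracStarGraph n} {f g : G.Space} {F Fh : Fin n → ℝ → ℂ} (c : ℂ)
    (h : G.IsRep f g F Fh) : G.IsRep (c • f) (c • g) (c • F) (c • Fh) := by
  refine ⟨fun j => (h.1 j).smul c, fun j => ?_⟩
  have e := h.2 j
  simp only [OuterBC, Pi.smul_apply, smul_eq_mul] at e ⊢
  linear_combination c * e

theorem IsRep.conj {G : DiracStarGraph n} {f g : G.Space} {F Fh : Fin n → ℝ → ℂ}
    (h : G.IsRep f g F Fh) :
    G.IsRep (conj f) (conj g) (fun j => star (F j)) (fun j => star (Fh j)) :=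
  ⟨fun j => (h.1 j).conj, fun j => (h.2 j).star⟩

theorem conj_smul {G : DiracStarGraph n} (c : ℂ) (f : G.Space) :
    conj (c • f) = star c • conj f := by
  ext1 j
  exact conjEdge_smul c (f j)

theorem IsRep.inner_sub_inner {G : DiracStarGraph n} {f g f' g' : G.Space}
    {F Fh F' Fh' : Fin n → ℝ → ℂ} (h : G.IsRep f g F Fh) (h' : G.IsRep f' g' F' Fh') :
    inner ℂ f g' - inner ℂ g f' =
      ∑ j, (star (Fh j 0) * F' j 0 - star (F j 0) * Fh' j 0) := by
  rw [PiLp.inner_apply, PiLp.inner_apply, ← Finset.sum_sub_distrib]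
  exact Finset.sum_congr rfl fun j _ => (h.1 j).inner_sub_inner (h'.1 j) (h.2 j) (h'.2 j)

theorem mem_graph_op_iff {G : DiracStarGraph n} {W : Submodule ℂ ((Fin n → ℂ) × (Fin n → ℂ))}
    {f g : G.Space} : (f, g) ∈ (G.op W).graph ↔
      ∃ F Fh, G.IsRep f g F Fh ∧ ((fun j => F j 0, fun j => Fh j 0) : _ × _) ∈ W := by
  rw [op_graph]
  exact ⟨fun ⟨F, Fh, h1, h2, h3⟩ => ⟨F, Fh, ⟨h1, h2⟩, h3⟩,
    fun ⟨F, Fh, ⟨h1, h2⟩, h3⟩ => ⟨F, Fh, h1, h2, h3⟩⟩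

/-- The vertex conditions under which the restriction is symmetric. -/
def IsIsotropic (W : Submodule ℂ ((Fin n → ℂ) × (Fin n → ℂ))) : Prop :=
  ∀ u ∈ W, ∑ j, (star (u.2 j) * u.1 j - star (u.1 j) * u.2 j) = 0

theorem isIsotropic_dirichlet : IsIsotropic (dirichlet n) := by
  intro u hu
  have hu' : ∀ j, u.1 j = 0 := hu
  simp [hu']

/-- The values `f_j(v)` agree, so the form involves only this common value and `∑ fh_j(v)`, which
are related by a real `τ` or else the sum vanishes. -/
theorem isIsotropic_robin (τ : EReal) : IsIsotropic (robin n τ) := by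
  rintro u ⟨h1, h2, h3⟩
  rcases isEmpty_or_nonempty (Fin n) with h | ⟨⟨i⟩⟩
  · simp
  have e : ∑ j, (star (u.2 j) * u.1 j - star (u.1 j) * u.2 j) =
      star (∑ j, u.2 j) * u.1 i - star (u.1 i) * ∑ j, u.2 j := by
    rw [star_sum, Finset.sum_mul, Finset.mul_sum, ← Finset.sum_sub_distrib]
    exact Finset.sum_congr rfl fun j _ => by rw [h1 j i]
  rw [e]
  induction τ with
  | bot => simp [h3]
  | top => simp [h3]
  | coe t =>
    rw [h2 t rfl i, star_mul']
    simp only [RCLike.star_def, Complex.conj_ofReal]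
    ring

theorem op_symmetric (G : DiracStarGraph n) {W : Submodule ℂ ((Fin n → ℂ) × (Fin n → ℂ))}
    (hW : IsIsotropic W) (f : (G.op W).domain) :
    (inner ℂ (f : G.Space) (G.op W f)).im = 0 := by
  obtain ⟨F, Fh, h, hm⟩ := mem_graph_op_iff.1 ((G.op W).mem_graph f)
  have e := (h.inner_sub_inner h).trans (hW _ hm)
  rw [← inner_conj_symm (G.op W f) (f : G.Space)] at e
  have := congrArg Complex.im e
  simp only [Complex.sub_im, Complex.conj_im, Complex.zero_im] at this
  linarith

theorem exists_weyl (G : DiracStarGraph n) {z : ℂ} (hz : z.im ≠ 0) :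
    ∃ (ψ : G.Space) (F Fh : Fin n → ℝ → ℂ), G.IsRep ψ (z • ψ) F Fh ∧
      (∀ j, F j 0 = 1) ∧ ∀ j, Fh j 0 = -G.m j z := by
  choose f F Fh h1 h2 h3 h4 using fun j => exists_weyl_edge G j hz
  exact ⟨WithLp.toLp 2 f, F, Fh, ⟨h1, h2⟩, h3, h4⟩

theorem exists_isResolventAt_T₀ (G : DiracStarGraph n) {z : ℂ} (hz : z.im ≠ 0) :
    ∃ R : G.Space →L[ℂ] G.Space, OperatorTheory.IsResolventAt G.T₀ z R ∧ ‖R‖ ≤ |z.im|⁻¹ := by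
  refine OperatorTheory.exists_isResolventAt_of_symmetric (T := G.T₀)
    (op_symmetric G isIsotropic_dirichlet) hz
    fun g => ?_
  choose f F Fh h1 h2 h3 using fun j => exists_dirichlet_edge G j hz (g j)
  have hm : (WithLp.toLp 2 f, z • WithLp.toLp 2 f + g) ∈ G.T₀.graph :=
    mem_graph_op_iff.2 ⟨F, Fh, ⟨h1, h2⟩, h3⟩
  obtain ⟨u, hu, e⟩ := (LinearPMap.mem_graph_iff _).1 hm
  refine ⟨u, ?_⟩
  simp only at hu e
  rw [e, hu, add_sub_cancel_left]

/-- Dividing by `τ` treats finite and infinite parameters alike, as `κ / τ = ∑ fh_j(v)`. -/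
theorem robin_mem {τ : EReal} (hτ : τ ≠ 0) {κ : ℂ} {u : Fin n → ℂ}
    (h : ((τ⁻¹).toReal : ℂ) * κ = ∑ j, u j) :
    ((fun _ => κ, u) : (Fin n → ℂ) × (Fin n → ℂ)) ∈ robin n τ := by
  refine ⟨fun _ _ => rfl, fun t ht _ => ?_, fun hτ' => ?_⟩
  · subst ht
    have ht0 : (t : ℂ) ≠ 0 := by
      rintro h0
      rw [Complex.ofReal_eq_zero] at h0
      exact hτ (by simp [h0])
    rw [← EReal.coe_inv, EReal.toReal_coe] at h
    simp only [← h]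
    push_cast
    field_simp
  · simp only [← h]
    rcases hτ' with rfl | rfl <;> simp

/-- At a zero of `m_τ` the Weyl vector satisfies the Robin condition and would be an eigenvector of
the symmetric operator `T_τ`. It is nonzero because there is at least one edge, where its value at
`v` is `1`. -/
theorem mRobin_ne_zero (hn : 1 ≤ n) (G : DiracStarGraph n) {τ : EReal} (hτ : τ ≠ 0) {z : ℂ}
    (hz : z.im ≠ 0) : G.mRobin τ z ≠ 0 := by
  intro h0
  obtain ⟨ψ, F, Fh, hψ, h1, h2⟩ := exists_weyl G hz
  have hm : (ψ, z • ψ) ∈ (G.T τ).graph := by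
    refine mem_graph_op_iff.2 ⟨F, Fh, hψ, ?_⟩
    simp only [h1]
    refine robin_mem hτ ?_
    simp only [h2, Finset.sum_neg_distrib]
    rw [mRobin] at h0
    linear_combination h0
  obtain ⟨u, hu, e⟩ := (LinearPMap.mem_graph_iff _).1 hm
  simp only at hu e
  have hu0 : u = 0 := OperatorTheory.eq_of_symmetric_of_sub_smul_eq
    (op_symmetric G (isIsotropic_robin τ)) hz (z := z) (f' := 0) (by
      change G.T τ u - _ = G.T τ 0 - _
      rw [e, hu]; simp)
  rw [hu0] at hu
  subst hu
  have := ((hψ.1 ⟨0, hn⟩).eqOn_zero).1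
  rw [h1] at this
  exact one_ne_zero this

end DiracStarGraph

/-! ### Krein's formula for the star graph and the main theorem -/

open DiracStarGraph in
theorem theorem5p6 (n : ℕ) (hn : 1 ≤ n) (G : DiracStarGraph n) (τ : EReal) (hτ : τ ≠ 0) :
    (∀ z : ℂ, z.im ≠ 0 →
      z ∈ OperatorTheory.resolventSet (G.T τ) ∧
      z ∈ OperatorTheory.resolventSet G.T₀ ∧
      (∀ j, G.cFun j z ≠ 0) ∧
      DifferentiableAt ℂ (G.mRobin τ) z ∧
      G.mRobin τ z ≠ 0 ∧
      OperatorTheory.HasTrace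
        (OperatorTheory.resolvent (G.T τ) z - OperatorTheory.resolvent G.T₀ z)
        (-(deriv (G.mRobin τ) z / G.mRobin τ z))) ∧
    OperatorTheory.IsPerturbationDeterminant (G.T τ) G.T₀ (G.mRobin τ) := by
  choose! R hR hRn using fun (z : ℂ) (hz : z.im ≠ 0) => exists_isResolventAt_T₀ G hz
  choose! ψ F Fh hψ hF hFh using fun (z : ℂ) (hz : z.im ≠ 0) => exists_weyl G hz
  -- The vector `conj (ψ z)` solves the equation at `z̄`, so Green's identity reduces its pairing
  -- with `g' - z f'` to values at `v`.
  have hconj : ∀ z : ℂ, z.im ≠ 0 → ∀ {f' g' : G.Space} {F' Fh' : Fin n → ℝ → ℂ},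
      G.IsRep f' g' F' Fh' → inner ℂ (conj (ψ z)) (g' - z • f') =
        -∑ j, (G.m j z * F' j 0 + Fh' j 0) := by
    intro z hz f' g' F' Fh' h'
    have e := (hψ z hz).conj.inner_sub_inner h'
    simp only [conj_smul, inner_smul_left, Pi.star_apply, star_star, hF z hz, hFh z hz] at e
    rw [inner_sub_right, inner_smul_right, ← Finset.sum_neg_distrib]
    simp only [RCLike.star_def, Complex.conj_conj] at e
    rw [e]
    exact Finset.sum_congr rfl fun j _ => by ring
  have key := OperatorTheory.hasTrace_and_isPerturbationDeterminant_of_krein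
    (T := G.T τ) (x := fun z => conj (ψ z)) hR hRn ?_ (M := G.mRobin τ) (ψ := ψ) ?_ ?_
    (fun z hz => mRobin_ne_zero hn G hτ hz)
  · exact ⟨fun z hz => ⟨(key.2.1 z hz).1, (key.2.1 z hz).2.1, fun j => cFun_ne_zero G j hz,
      (key.2.1 z hz).2.2.1, (key.2.1 z hz).2.2.2, key.1 z hz⟩, key.2⟩
  · intro z hz
    refine OperatorTheory.isResolventAt_of_symmetric (T := G.T τ)
      (op_symmetric G (isIsotropic_robin τ)) hz fun g => ?_
    obtain ⟨hd, e⟩ := (hR z hz).1 g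
    obtain ⟨U, Uh, hU, hU0⟩ := mem_graph_op_iff.1 (G.T₀.mem_graph ⟨R z g, hd⟩)
    have hU0' : ∀ j, U j 0 = 0 := hU0
    have hM := mRobin_ne_zero hn G hτ hz
    have hx := hconj z hz hU
    simp only at hx
    rw [e] at hx
    simp only [hU0', mul_zero, zero_add] at hx
    -- Adding `κ ψ z` to `R z g` gives the common value `κ` and the sum `∑ Uh_j(v) - κ ∑ m_j(z)`.
    -- The Robin condition thus asks for `κ m_τ(z) = ∑ Uh_j(v)`, and by `hconj` this sum is `-⟪conj
    -- (ψ z), g⟫`.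
    set κ : ℂ := -((G.mRobin τ z)⁻¹ * inner ℂ (conj (ψ z)) g) with hκ
    have hκM : κ * G.mRobin τ z = ∑ j, Uh j 0 := by
      rw [hκ, hx]
      field_simp
    have hRg : (R z - (G.mRobin τ z)⁻¹ • InnerProductSpace.rankOne ℂ (ψ z) (conj (ψ z))) g =
        R z g + κ • ψ z := by
      simp [hκ, smul_smul, sub_eq_add_neg]
    rw [hRg]
    refine mem_graph_op_iff.2 ⟨U + κ • F z, Uh + κ • Fh z, ?_, ?_⟩
    · have h := hU.add ((hψ z hz).smul κ)
      have e2 : G.T₀ ⟨R z g, hd⟩ = g + z • R z g := sub_eq_iff_eq_add.1 e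
      rw [e2] at h
      convert h using 1
      module
    · simp only [Pi.add_apply, Pi.smul_apply, smul_eq_mul, hU0', hF z hz, hFh z hz, zero_add,
        mul_one]
      refine robin_mem hτ ?_
      rw [mRobin] at hκM
      rw [Finset.sum_add_distrib, ← hκM, ← Finset.mul_sum, Finset.sum_neg_distrib]
      ring
  · intro a z ha hz
    -- All values at `v` are `1 - 1 = 0`, so the difference lies in the domain of `T₀`, and `T₀ - z`
    -- maps it to `(z - a) ψ a`.
    have hm : (ψ z - ψ a, z • ψ z - a • ψ a) ∈ G.T₀.graph := by
      refine mem_graph_op_iff.2 ⟨F z + (-1 : ℂ) • F a, Fh z + (-1 : ℂ) • Fh a, ?_,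
        fun j => ?_⟩
      · have := (hψ z hz).add ((hψ a ha).smul (-1))
        simpa only [neg_smul, one_smul, ← sub_eq_add_neg] using this
      · simp [hF z hz, hF a ha]
    obtain ⟨u, hu, e⟩ := (LinearPMap.mem_graph_iff _).1 hm
    simp only at hu e
    have h := (hR z hz).2 u
    have h2 : z • ψ z - a • ψ a - z • (ψ z - ψ a) = (z - a) • ψ a := by module
    rw [e, hu, h2, map_smul] at h
    rw [h, add_sub_cancel]
  · intro a z ha hz
    -- Here `g' - a f' = (z - a) ψ z`, with boundary terms `m_j(a) - m_j(z)`; the constant `1/τ`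
    -- cancels.
    have e := hconj a ha (hψ z hz)
    simp only [← sub_smul, inner_smul_right, hF z hz, hFh z hz] at e
    rw [e, mRobin, mRobin, add_sub_add_left_eq_sub, ← Finset.sum_sub_distrib,
      ← Finset.sum_neg_distrib]
    exact Finset.sum_congr rfl fun j _ => by ring
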